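/- **Setting.** Let $\mathcal G$ be a star graph with central vertex $v$ and edges $e_j$, $j=1,\dots,n$, identified with compact intervals $[v,v_j]$, $v<v_j$. Let $p_j,q_j\in L^1(e_j,\mathbb R)$, $\alpha_j\in[0,\pi)$, $J=\begin{pmatrix}0&-1\\1&0\end{pmatrix}$, $V_j=\begin{pmatrix}p_j&q_j\\q_j&-p_j\end{pmatrix}$ and $H_j=-J\frac{d}{dx}+V_j$. Let $L^2(\mathcal G)=\bigoplus_{j=1}^n L^2(e_j,\mathbb C^2)$, with elements $f=(f_j\ \hat f_j)_{j=1}^n$. Let $\mathcal D_j$ be the set of $(f_j\ \hat f_j)^{\rm t}\in L^2(e_j,\mathbb C^2)$ that are absolutely continuous, satisfy $H_j(f_j\ \hat f_j)^{\rm t}\in L^2(e_j,\mathbb C^2)$ and $\cos\alpha_j\,f_j(v_j)+\sin\alpha_j\,\hat f_j(v_j)=0$. For $f$ with components in $\mathcal D_j$ put $f_1^\sharp(v)=(f_j(v))_{j=1}^n$ and $f_2^\sharp(v)=(\hat f_j(v))_{j=1}^n$. The minimal operator $\mathcal S$ acts as $H_j$ on each edge, on all such $f$ with $f_1^\sharp(v)=f_2^\sharp(v)=0$.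 It is densely defined, and $\mathcal S^*$ acts as $H_j$ on each edge with domain $\bigoplus_j\mathcal D_j$. Let $Y_j(\cdot,z)$, $z\in\mathbb C$, be the solution of $-JY_j'+V_jY_j=zY_j$ on $e_j$ with $Y_j(v,z)=I_2$ (it exists), with entries $y_{j,kl}$, let $\mathbf Y=\operatorname{diag}(Y_1,\dots,Y_n)$, and let $$m_j(z)=\frac{y_{j,11}(v_j,z)\cos\alpha_j+y_{j,21}(v_j,z)\sin\alpha_j}{y_{j,12}(v_j,z)\cos\alpha_j+y_{j,22}(v_j,z)\sin\alpha_j},\qquad M(z)=\operatorname{diag}(m_1(z),\dots,m_n(z)).$$ Let $P$ be the $2n\times 2n$ permutation matrix with $P(u_1,\hat u_1,\dots,u_n,\hat u_n)^{\rm t}=(u_1,\dots,u_n,\hat u_1,\dots,\hat u_n)^{\rm t}$, let $\Gamma_z:\mathbb C^n\to L^2(\mathcal G)$, $\Gamma_zc=\mathbf Y(\cdot,z)P^{\rm t}\begin{pmatrix}-I_n\\M(z)\end{pmatrix}c$, and let $I(g,z)=\Big(\int_v^{v_j}Y_j(\xi,\bar z)^*g_j(\xi)\,d\xi\Big)_{j=1}^n\in\mathbb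 C^{2n}$ for $g=(g_j)_{j=1}^n\in L^2(\mathcal G)$. For $A,B\in M_n(\mathbb C)$ let $\mathcal T_{A,B}$ be the restriction of $\mathcal S^*$ by the condition $A f_1^\sharp(v)+B f_2^\sharp(v)=0$, and let $\mathcal T_0=\mathcal T_{I_n,0_n}$. **Theorem.** (i) The self-adjoint extensions of $\mathcal S$ in $L^2(\mathcal G)$ are exactly the operators $\mathcal T_{A,B}$ with $A,B\in M_n(\mathbb C)$ such that $$\operatorname{rank}(A\ \ B)=n,\qquad AB^*=BA^*.\tag{1}$$ Let $A,B$ satisfy (1). (ii) We have $\mathbb C\setminus\mathbb R\subset\rho(\mathcal T_0)\cap\rho(\mathcal T_{A,B})$. The denominators of all $m_j$ are non-zero on $\rho(\mathcal T_0)$. For every $z\in\rho(\mathcal T_0)\cap\rho(\mathcal T_{A,B})$ the matrix $BM(z)-A$ is invertible and $$(\mathcal T_{A,B}-z)^{-1}=(\mathcal T_0-z)^{-1}-\Gamma_z\,(BM(z)-A)^{-1}B\,\Gamma_{\bar z}^*.$$ (iii) There exist $C,D\in M_n(\mathbb C)$ with $$\operatorname{rank}(C\ \ D)=n,\qquad CD^*=DC^*,\qquad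 BC^*-AD^*=I_n.$$ For all such $C,D$ the function $W_{A,B}(z)=(DM(z)-C)(BM(z)-A)^{-1}$ is a matrix Nevanlinna function, i.e. it is holomorphic on $\mathbb C\setminus\mathbb R$ and satisfies $W_{A,B}(\bar z)=W_{A,B}(z)^*$ and $\operatorname{Im}W_{A,B}(z)/\operatorname{Im}z\ge0$ there; it is meromorphic on $\mathbb C$; and there is an entire function $F$ whose values are bounded linear operators in $L^2(\mathcal G)$ such that $$(\mathcal T_{A,B}-z)^{-1}g=\mathbf Y(\cdot,z)P^{\rm t}\begin{pmatrix}B^*\\-A^*\end{pmatrix}W_{A,B}(z)\,(B\ \ {-A})\,P\,I(g,z)+F(z)g$$ for all $g\in L^2(\mathcal G)$ and $z\in\rho(\mathcal T_0)\cap\rho(\mathcal T_{A,B})$. -/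

import Mathlib

open MeasureTheory
open scoped Matrix ComplexConjugate ComplexOrder InnerProductSpace

noncomputable section

/-! ### Resolvents of partially defined operators -/

namespace DiracKrein

section Resolvent

variable {H : Type*} [NormedAddCommGroup H] [NormedSpace ℂ H]

/-- `R` is the bounded everywhere defined inverse of `T - z : dom T → H`. -/
def IsResolventAt (T : H →ₗ.[ℂ] H) (z : ℂ) (R : H →L[ℂ] H) : Prop :=
  (∀ g : H, ∃ f : T.domain, (f : H) = R g ∧ T f - z • (f : H) = g) ∧
    ∀ f : T.domain, R (T f - z • (f : H)) = f

/-- The resolvent set `ρ(T)`. -/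
def rho (T : H →ₗ.[ℂ] H) : Set ℂ := {z | ∃ R : H →L[ℂ] H, IsResolventAt T z R}

open Classical in
/-- The resolvent `(T - z)⁻¹`, meaningful for `z ∈ ρ(T)` (and `0` otherwise). -/
def res (T : H →ₗ.[ℂ] H) (z : ℂ) : H →L[ℂ] H :=
  if h : ∃ R : H →L[ℂ] H, IsResolventAt T z R then h.choose else 0

end Resolvent

/-! ### Matrix pairs and matrix Nevanlinna functions -/

section Matrices

variable {n : ℕ}

/-- The conditions `rank (A B) = n` and `A B* = B A*`. -/
def IsSelfAdjointPair (A B : Matrix (Fin n) (Fin n) ℂ) : Prop :=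
  (Matrix.fromCols A B).rank = n ∧ A * Bᴴ = B * Aᴴ

/-- `C, D` is a pair complementary to `A, B`: `rank (C D) = n`, `C D* = D C*` and
`B C* - A D* = I`. -/
def IsComplementaryPair (A B C D : Matrix (Fin n) (Fin n) ℂ) : Prop :=
  IsSelfAdjointPair C D ∧ B * Cᴴ - A * Dᴴ = 1

/-- Matrix Nevanlinna functions: holomorphic on `ℂ \ ℝ`, with `N(z̄) = N(z)*` and
`Im N(z) / Im z ≥ 0`, where `Im N = (N - N*) / (2i)`. -/
structure IsMatrixNevanlinna (N : ℂ → Matrix (Fin n) (Fin n) ℂ) : Prop where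
  holomorphic : ∀ i k, DifferentiableOn ℂ (fun z => N z i k) {z : ℂ | z.im ≠ 0}
  symmetric : ∀ z : ℂ, z.im ≠ 0 → N (conj z) = (N z)ᴴ
  im_nonneg : ∀ z : ℂ, z.im ≠ 0 →
    (((z.im : ℂ)⁻¹ * (2 * Complex.I)⁻¹) • (N z - (N z)ᴴ)).PosSemidef

/-- The permutation matrix sending `(u₁, û₁, …, uₙ, ûₙ)` to `(u₁, …, uₙ, û₁, …, ûₙ)`. The entries
`u_j`, `û_j` of the original vector have the indices `(j, 0)`, `(j, 1)`. -/
def permMatrix (n : ℕ) : Matrix (Fin n ⊕ Fin n) (Fin n × Fin 2) ℂ :=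
  Matrix.of fun r c =>
    match r with
    | Sum.inl i => if c = (i, 0) then 1 else 0
    | Sum.inr i => if c = (i, 1) then 1 else 0

/-- The matrix `J`. -/
def J : Matrix (Fin 2) (Fin 2) ℂ := !![0, -1; 1, 0]

end Matrices

/-! ### The star graph and its Dirac-Krein operators -/

/-- The data of a Dirac-Krein system on a compact star graph with `n` edges: the edge `e_j` is
identified with the interval `[v, w j]`, directed away from the central vertex `v`; the real
potentials `p j`, `q j` are summable on `e_j`, and `α j ∈ [0, π)` is the parameter of the boundary
condition at the outer vertex. -/
structure StarGraph (n : ℕ) where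
  v : ℝ
  w : Fin n → ℝ
  v_lt_w : ∀ j, v < w j
  p : Fin n → ℝ → ℝ
  q : Fin n → ℝ → ℝ
  p_integrable : ∀ j, IntegrableOn (p j) (Set.Icc v (w j))
  q_integrable : ∀ j, IntegrableOn (q j) (Set.Icc v (w j))
  α : Fin n → ℝ
  α_mem : ∀ j, α j ∈ Set.Ico 0 Real.pi

namespace StarGraph

variable {n : ℕ} (G : StarGraph n)

/-- Lebesgue measure on the edge `e_j`. -/
def μ (j : Fin n) : Measure ℝ := volume.restrict (Set.Icc G.v (G.w j))

/-- The Hilbert space of square integrable `ℂ²`-valued functions on the edge `e_j`. -/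
abbrev EdgeL2 (j : Fin n) : Type := Lp (EuclideanSpace ℂ (Fin 2)) 2 (G.μ j)

/-- The Hilbert space `L²(𝒢)`, the orthogonal sum of the spaces `L²(e_j)`. -/
abbrev L2 : Type := PiLp 2 (fun j : Fin n => G.EdgeL2 j)

/-- The potential matrix `V_j(x)`. -/
def V (j : Fin n) (x : ℝ) : Matrix (Fin 2) (Fin 2) ℂ :=
  !![(G.p j x : ℂ), (G.q j x : ℂ); (G.q j x : ℂ), -(G.p j x : ℂ)]

/-- The differential expression `H_j F = -J F' + V_j F`. -/
def diracExpr (j : Fin n) (F : ℝ → Fin 2 → ℂ) (x : ℝ) : Fin 2 → ℂ :=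
  -(J *ᵥ deriv F x) + G.V j x *ᵥ F x

/-- The function `F` on `e_j` is an absolutely continuous representative of `f ∈ L²(e_j)`, it
satisfies the boundary condition `cos α_j F₁ + sin α_j F₂ = 0` at the outer vertex, and
`H_j F = g ∈ L²(e_j)`. Thus `f` belongs to the maximal domain `𝓓_j`, and `g = H_j f`. -/
structure IsEdgeFunction (j : Fin n) (F : ℝ → Fin 2 → ℂ) (f g : G.EdgeL2 j) : Prop where
  absCont : AbsolutelyContinuousOnInterval F G.v (G.w j)
  rep : ∀ᵐ x ∂(G.μ j), WithLp.ofLp (f x) = F x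
  outer : (Real.cos (G.α j) : ℂ) * F (G.w j) 0 + (Real.sin (G.α j) : ℂ) * F (G.w j) 1 = 0
  expr : ∀ᵐ x ∂(G.μ j), WithLp.ofLp (g x) = G.diracExpr j F x

theorem ae_differentiableAt_of_absCont {F : ℝ → Fin 2 → ℂ} {j : Fin n}
    (hF : AbsolutelyContinuousOnInterval F G.v (G.w j)) :
    ∀ᵐ x ∂(G.μ j), DifferentiableAt ℝ F x := by
  have h := hF.boundedVariationOn.locallyBoundedVariationOn.ae_differentiableWithinAt_of_mem
  rw [Set.uIcc_of_le (G.v_lt_w j).le] at h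
  have h1 : ∀ᵐ x : ℝ, x ≠ G.v := by simp [ae_iff]
  have h2 : ∀ᵐ x : ℝ, x ≠ G.w j := by simp [ae_iff]
  rw [μ, ae_restrict_iff' measurableSet_Icc]
  filter_upwards [h, h1, h2] with x hx hx1 hx2 hxm
  exact (hx hxm).differentiableAt
    (Icc_mem_nhds (lt_of_le_of_ne hxm.1 (Ne.symm hx1)) (lt_of_le_of_ne hxm.2 hx2))

theorem IsEdgeFunction.add {j : Fin n} {F F' : ℝ → Fin 2 → ℂ} {f g f' g' : G.EdgeL2 j}
    (h : G.IsEdgeFunction j F f g) (h' : G.IsEdgeFunction j F' f' g') :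
    G.IsEdgeFunction j (F + F') (f + f') (g + g') where
  absCont := h.absCont.add h'.absCont
  rep := by
    filter_upwards [h.rep, h'.rep, Lp.coeFn_add f f'] with x h1 h2 h3
    rw [h3, Pi.add_apply, WithLp.ofLp_add, h1, h2, Pi.add_apply]
  outer := by
    have h1 := h.outer
    have h2 := h'.outer
    simp only [Pi.add_apply]
    linear_combination h1 + h2
  expr := by
    filter_upwards [h.expr, h'.expr, Lp.coeFn_add g g', G.ae_differentiableAt_of_absCont h.absCont,
      G.ae_differentiableAt_of_absCont h'.absCont] with x h1 h2 h3 h4 h5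
    rw [h3, Pi.add_apply, WithLp.ofLp_add, h1, h2]
    simp only [diracExpr, deriv_add h4 h5, Pi.add_apply, Matrix.mulVec_add]
    abel

theorem IsEdgeFunction.smul {j : Fin n} {F : ℝ → Fin 2 → ℂ} {f g : G.EdgeL2 j} (c : ℂ)
    (h : G.IsEdgeFunction j F f g) : G.IsEdgeFunction j (c • F) (c • f) (c • g) where
  absCont := h.absCont.const_smul c
  rep := by
    filter_upwards [h.rep, Lp.coeFn_smul c f] with x h1 h3
    rw [h3, Pi.smul_apply, WithLp.ofLp_smul, h1, Pi.smul_apply]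
  outer := by
    have h1 := h.outer
    simp only [Pi.smul_apply, smul_eq_mul]
    linear_combination c * h1
  expr := by
    filter_upwards [h.expr, Lp.coeFn_smul c g, G.ae_differentiableAt_of_absCont h.absCont]
      with x h1 h3 h4
    rw [h3, Pi.smul_apply, WithLp.ofLp_smul, h1]
    have hd : deriv (c • F) x = c • deriv F x := deriv_const_smul c h4
    simp only [diracExpr, hd, Pi.smul_apply, Matrix.mulVec_smul, smul_add, smul_neg]

theorem IsEdgeFunction.zero (j : Fin n) : G.IsEdgeFunction j 0 0 0 := by
  have h0 : AbsolutelyContinuousOnInterval (0 : ℝ → Fin 2 → ℂ) G.v (G.w j) := by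
    simp [AbsolutelyContinuousOnInterval, tendsto_const_nhds]
  refine ⟨h0, ?_, by simp, ?_⟩
  · filter_upwards [Lp.coeFn_zero (EuclideanSpace ℂ (Fin 2)) 2 (G.μ j)] with x hx
    rw [hx]; rfl
  · filter_upwards [Lp.coeFn_zero (EuclideanSpace ℂ (Fin 2)) 2 (G.μ j)] with x hx
    have hd : deriv (0 : ℝ → Fin 2 → ℂ) x = 0 := deriv_const x 0
    rw [hx, diracExpr, hd]; simp

/-- An absolutely continuous representative is determined by its class on `e_j`; in particular
`H_j f` is determined by `f`. -/
theorem IsEdgeFunction.eq_zero {j : Fin n} {F : ℝ → Fin 2 → ℂ} {f g : G.EdgeL2 j}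
    (h : G.IsEdgeFunction j F f g) (hf : f = 0) :
    (∀ x ∈ Set.Icc G.v (G.w j), F x = 0) ∧ g = 0 := by
  have hlt := G.v_lt_w j
  have hc := h.absCont.continuousOn
  rw [Set.uIcc_of_le hlt.le] at hc
  have hz : ∀ᵐ x ∂(G.μ j), F x = (0 : ℝ → Fin 2 → ℂ) x := by
    filter_upwards [h.rep, Lp.coeFn_zero (EuclideanSpace ℂ (Fin 2)) 2 (G.μ j)] with x h1 h2
    rw [← h1, hf, h2]; rfl
  have hF : Set.EqOn F 0 (Set.Icc G.v (G.w j)) :=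
    Measure.eqOn_Icc_of_ae_eq volume hlt.ne hz hc continuousOn_const
  refine ⟨hF, ?_⟩
  have h1 : ∀ᵐ x : ℝ, x ≠ G.v := by simp [ae_iff]
  have h2 : ∀ᵐ x : ℝ, x ≠ G.w j := by simp [ae_iff]
  have hmem : ∀ᵐ x ∂(G.μ j), x ∈ Set.Icc G.v (G.w j) := ae_restrict_mem measurableSet_Icc
  rw [Lp.eq_zero_iff_ae_eq_zero]
  filter_upwards [h.expr, hmem, ae_restrict_of_ae h1, ae_restrict_of_ae h2] with x hx hm hx1 hx2
  have hn : Set.Icc G.v (G.w j) ∈ nhds x :=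
    Icc_mem_nhds (lt_of_le_of_ne hm.1 (Ne.symm hx1)) (lt_of_le_of_ne hm.2 hx2)
  have he : F =ᶠ[nhds x] fun _ => (0 : Fin 2 → ℂ) := by
    filter_upwards [hn] with y hy using hF hy
  have hd : deriv F x = 0 := by rw [he.deriv_eq]; exact deriv_const x 0
  have hx0 : WithLp.ofLp (g x) = 0 := by
    rw [hx, diracExpr, hd, hF hm]; simp
  exact (WithLp.ofLp_eq_zero 2).1 hx0

/-- The graph of the operator acting as `H_j` on every edge `e_j`, on the functions `f` with
components in `𝓓_j` whose boundary values
`(f₁♯(v), f₂♯(v)) = ((f_j(v))_j, (f̂_j(v))_j)` at the central vertex lie in `L`. -/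
def vertexGraph (L : Submodule ℂ ((Fin n → ℂ) × (Fin n → ℂ))) :
    Submodule ℂ (G.L2 × G.L2) where
  carrier := {fg | ∃ F : Fin n → ℝ → Fin 2 → ℂ,
    (∀ j, G.IsEdgeFunction j (F j) (fg.1 j) (fg.2 j)) ∧
      ((fun j => F j G.v 0, fun j => F j G.v 1) : (Fin n → ℂ) × (Fin n → ℂ)) ∈ L}
  add_mem' := by
    rintro a b ⟨F, hF, hL⟩ ⟨F', hF', hL'⟩
    exact ⟨F + F', fun j => (hF j).add G (hF' j), L.add_mem hL hL'⟩
  zero_mem' := ⟨0, fun j => IsEdgeFunction.zero G j, L.zero_mem⟩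
  smul_mem' := by
    rintro c a ⟨F, hF, hL⟩
    exact ⟨c • F, fun j => (hF j).smul G c, L.smul_mem c hL⟩

theorem vertexGraph_snd_eq_zero (L : Submodule ℂ ((Fin n → ℂ) × (Fin n → ℂ)))
    (a : G.L2 × G.L2) (ha : a ∈ G.vertexGraph L) (h0 : a.1 = 0) : a.2 = 0 := by
  obtain ⟨F, hF, -⟩ := ha
  ext1 j
  exact ((hF j).eq_zero G (by rw [h0]; rfl)).2

/-- The operator in `L²(𝒢)` with the graph `vertexGraph L`. -/
def vertexOp (L : Submodule ℂ ((Fin n → ℂ) × (Fin n → ℂ))) : G.L2 →ₗ.[ℂ] G.L2 :=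
  (G.vertexGraph L).toLinearPMap

/-- The defining property of `vertexOp`. -/
theorem vertexOp_graph (L : Submodule ℂ ((Fin n → ℂ) × (Fin n → ℂ))) :
    (G.vertexOp L).graph = G.vertexGraph L :=
  Submodule.toLinearPMap_graph_eq _ (G.vertexGraph_snd_eq_zero L)

/-- The minimal operator `S = S₁ ⊕ ⋯ ⊕ Sₙ`: all components vanish at the central vertex. -/
def S : G.L2 →ₗ.[ℂ] G.L2 := G.vertexOp ⊥

/-- The maximal operator, with domain `𝓓₁ ⊕ ⋯ ⊕ 𝓓ₙ`: no condition at the central vertex. -/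
def Smax : G.L2 →ₗ.[ℂ] G.L2 := G.vertexOp ⊤

/-- The restriction `T_{A,B}` of the maximal operator by the vertex condition
`A f₁♯(v) + B f₂♯(v) = 0`. -/
def T (A B : Matrix (Fin n) (Fin n) ℂ) : G.L2 →ₗ.[ℂ] G.L2 :=
  G.vertexOp (LinearMap.ker (A.mulVecLin.coprod B.mulVecLin))

/-- The decoupled operator `T₀ = T_{I,0}`: Dirichlet conditions `f_j(v) = 0` on every edge. -/
def T₀ : G.L2 →ₗ.[ℂ] G.L2 := G.T 1 0

/-! ### Fundamental matrices, Weyl-Titchmarsh functions and `Γ_z` -/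

/-- `Y` is the fundamental matrix on `e_j`: its columns are absolutely continuous,
`-J Y' + V_j Y = z Y` almost everywhere on `e_j`, and `Y(v) = I`. -/
structure IsFundamentalMatrix (j : Fin n) (z : ℂ) (Y : ℝ → Matrix (Fin 2) (Fin 2) ℂ) : Prop where
  absCont : ∀ l, AbsolutelyContinuousOnInterval (fun x => (Y x).col l) G.v (G.w j)
  eqn : ∀ l, ∀ᵐ x ∂(G.μ j), G.diracExpr j (fun y => (Y y).col l) x = z • (Y x).col l
  initial : Y G.v = 1

open Classical in
/-- The fundamental matrix `Y_j(·, z)`, chosen through its defining initial value problem, whose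
solution is unique on `e_j` (the value `0` would only be used if there were no solution). -/
def Y (j : Fin n) (z : ℂ) : ℝ → Matrix (Fin 2) (Fin 2) ℂ :=
  if h : ∃ Y, G.IsFundamentalMatrix j z Y then h.choose else 0

theorem continuousOn_Y_col (j : Fin n) (z : ℂ) (l : Fin 2) :
    ContinuousOn (fun x => (G.Y j z x).col l) (Set.Icc G.v (G.w j)) := by
  unfold Y
  split_ifs with h
  · have := (h.choose_spec.absCont l).continuousOn
    rwa [Set.uIcc_of_le (G.v_lt_w j).le] at this
  · exact (continuousOn_const : ContinuousOn (fun _ : ℝ => (0 : Fin 2 → ℂ)) _)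

theorem memLp_Y_mulVec (j : Fin n) (z : ℂ) (u : Fin 2 → ℂ) :
    MemLp (fun x => WithLp.toLp 2 (G.Y j z x *ᵥ u) : ℝ → EuclideanSpace ℂ (Fin 2)) 2 (G.μ j) := by
  have hc : ContinuousOn
      (fun x => WithLp.toLp 2 (G.Y j z x *ᵥ u) : ℝ → EuclideanSpace ℂ (Fin 2))
      (Set.Icc G.v (G.w j)) := by
    have hc' : ContinuousOn (fun x => G.Y j z x *ᵥ u) (Set.Icc G.v (G.w j)) := by
      refine continuousOn_pi.2 fun i => ?_
      simp only [Matrix.mulVec, dotProduct]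
      refine continuousOn_finsetSum _ fun l _ => ContinuousOn.mul ?_ continuousOn_const
      exact continuousOn_pi.1 (G.continuousOn_Y_col j z l) i
    exact (PiLp.continuous_toLp 2 (fun _ : Fin 2 => ℂ)).comp_continuousOn hc'
  obtain ⟨K, hK⟩ := isCompact_Icc.exists_bound_of_continuousOn hc
  have : IsFiniteMeasure (G.μ j) := by unfold μ; infer_instance
  exact MemLp.of_bound (hc.aestronglyMeasurable measurableSet_Icc) K
    ((ae_restrict_mem measurableSet_Icc).mono hK)

/-- The map `u ↦ 𝐘(·, z) u` from `ℂ²ⁿ` to `L²(𝒢)`, where `𝐘 = diag(Y₁, …, Yₙ)`. -/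
def evalY (z : ℂ) : (Fin n × Fin 2 → ℂ) →ₗ[ℂ] G.L2 where
  toFun u := WithLp.toLp 2 fun j => (G.memLp_Y_mulVec j z (fun k => u (j, k))).toLp _
  map_add' u u' := by
    ext1 j
    have h1 := G.memLp_Y_mulVec j z (fun k => u (j, k))
    have h2 := G.memLp_Y_mulVec j z (fun k => u' (j, k))
    have h3 := G.memLp_Y_mulVec j z (fun k => (u + u') (j, k))
    have e : h3.toLp _ = h1.toLp _ + h2.toLp _ := by
      rw [← MemLp.toLp_add h1 h2]
      refine MemLp.toLp_congr h3 (h1.add h2) (Filter.Eventually.of_forall fun x => ?_)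
      exact congrArg (WithLp.toLp 2)
        (Matrix.mulVec_add (G.Y j z x) (fun k => u (j, k)) (fun k => u' (j, k)))
    exact e
  map_smul' c u := by
    ext1 j
    have h1 := G.memLp_Y_mulVec j z (fun k => u (j, k))
    have h3 := G.memLp_Y_mulVec j z (fun k => (c • u) (j, k))
    have e : h3.toLp _ = c • h1.toLp _ := by
      rw [← MemLp.toLp_const_smul c h1]
      refine MemLp.toLp_congr h3 (h1.const_smul c) (Filter.Eventually.of_forall fun x => ?_)
      exact congrArg (WithLp.toLp 2) (Matrix.mulVec_smul (G.Y j z x) c (fun k => u (j, k)))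
    exact e

/-- The vector `I(g, z) = (∫ Y_j(ξ, z̄)* g_j(ξ) dξ)_j ∈ ℂ²ⁿ`. -/
def edgeIntegral (g : G.L2) (z : ℂ) : Fin n × Fin 2 → ℂ := fun jk =>
  ∫ ξ in Set.Icc G.v (G.w jk.1), ((G.Y jk.1 (conj z) ξ)ᴴ *ᵥ WithLp.ofLp (g jk.1 ξ)) jk.2

/-- The numerator of `m_j`. -/
def b (j : Fin n) (z : ℂ) : ℂ :=
  G.Y j z (G.w j) 0 0 * (Real.cos (G.α j) : ℂ) + G.Y j z (G.w j) 1 0 * (Real.sin (G.α j) : ℂ)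

/-- The denominator of `m_j`. -/
def c (j : Fin n) (z : ℂ) : ℂ :=
  G.Y j z (G.w j) 0 1 * (Real.cos (G.α j) : ℂ) + G.Y j z (G.w j) 1 1 * (Real.sin (G.α j) : ℂ)

/-- The Weyl-Titchmarsh function of the edge `e_j` (to be used only where `c_j(z) ≠ 0`). -/
def m (j : Fin n) (z : ℂ) : ℂ := G.b j z / G.c j z

/-- `M(z) = diag(m₁(z), …, mₙ(z))`. -/
def M (z : ℂ) : Matrix (Fin n) (Fin n) ℂ := Matrix.diagonal fun j => G.m j z

/-- `Γ_z c = 𝐘(·, z) Pᵗ (-I; M(z)) c`. -/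
def Γ (z : ℂ) : EuclideanSpace ℂ (Fin n) →L[ℂ] G.L2 :=
  LinearMap.toContinuousLinearMap
    (G.evalY z ∘ₗ ((permMatrix n)ᵀ * Matrix.fromRows (-1) (G.M z)).mulVecLin ∘ₗ
      (WithLp.linearEquiv 2 ℂ (Fin n → ℂ)).toLinearMap)

/-- `W_{A,B}(z) = (D M(z) - C) (B M(z) - A)⁻¹`. -/
def W (A B C D : Matrix (Fin n) (Fin n) ℂ) (z : ℂ) : Matrix (Fin n) (Fin n) ℂ :=
  (D * G.M z - C) * (B * G.M z - A)⁻¹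

end StarGraph

end DiracKrein

end

noncomputable section

/-! ### Absolutely continuous functions -/

namespace AbsolutelyContinuousOnInterval

open Set

/-! On each edge the equation `H F = z F + g` is the first-order system `F' = J (z - V) F + J g`,
hence a Volterra integral equation with summable coefficient. Its operator is quasinilpotent and
affine in `z`, so the solution operator `solOp` exists for every `z` and is entire. This makes
fundamental matrices, `I(g, z)` and the solution with zero initial value entire in `z`.

Green's identity with the columns of `Y_j(·, z̄)` shows that a solution with initial value `u`
satisfies the outer condition if and only if `b_j (u_j - I_{j,1}) + c_j (û_j + I_{j,0}) = 0`. Thus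
(`mem_vertexGraph_iff`) solving `(T - z) f = g` for a realisation with boundary values in a subspace
`L` is finite linear algebra: find `u` in `L` satisfying this equation on each edge.

For (i), at `z = 0` the range of `S` is the orthogonal complement of the `n`-dimensional space of
solutions of `H f = 0` satisfying the outer conditions. This gives `S* = Smax`, and that every
boundary value is attained. By Green's identity on the graph, the adjoint of the realisation for `L`
is the realisation for its symplectic complement. Self-adjoint extensions therefore correspond to
Lagrangian `L`, and these are the kernels of the row matrices `(A B)` satisfying (1).

For (ii), with `X = B M - A` and `r = M I₁ - I₀ = Γ_{z̄}* g`, the two linear conditions on the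
boundary data give `f₁♯(v) = X⁻¹ B r`; subtracting the case of `T₀`, where this value is zero,
leaves Krein's formula. Non-invertibility of `X`, or a zero of `c_j`, would produce an
eigenfunction.

For (iii), `(A B; C D)` is invertible with an explicit inverse, which yields column relations and
the identity `symplectic_identity`. Hence `Im W = (X⁻¹)* (Im M) X⁻¹`, where `Im M ≥ 0` for `Im z >
0` by Green's identity. The same relations show that the matrix mapping `I(g, z)` to the boundary
data of the resolvent is the `W` term plus a constant matrix, and this constant generates the entire
function `F`. -/

theorem congr {X : Type*} [PseudoMetricSpace X] {f g : ℝ → X} {a b : ℝ}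
    (hf : AbsolutelyContinuousOnInterval f a b) (h : EqOn f g (uIcc a b)) :
    AbsolutelyContinuousOnInterval g a b := by
  rw [absolutelyContinuousOnInterval_iff] at hf ⊢
  intro ε hε
  obtain ⟨δ, hδ, H⟩ := hf ε hε
  refine ⟨δ, hδ, fun E hE hs => ?_⟩
  convert H E hE hs using 1
  refine Finset.sum_congr rfl fun i hi => ?_
  rw [h (hE.1 i hi).1, h (hE.1 i hi).2]

/-- The sums of increments of `g` are at most `C` times those of `f`. Both linear images and
vector-valued primitives are reduced to known functions in this way. -/
theorem of_dist_le {X Y : Type*} [PseudoMetricSpace X] [PseudoMetricSpace Y] {f : ℝ → X}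
    {g : ℝ → Y} {a b C : ℝ} (hf : AbsolutelyContinuousOnInterval f a b)
    (h : ∀ x ∈ uIcc a b, ∀ y ∈ uIcc a b, dist (g x) (g y) ≤ C * dist (f x) (f y)) :
    AbsolutelyContinuousOnInterval g a b := by
  rw [AbsolutelyContinuousOnInterval] at hf ⊢
  refine squeeze_zero' (Filter.Eventually.of_forall fun E =>
    Finset.sum_nonneg fun i _ => dist_nonneg) ?_ (by simpa using hf.const_mul C)
  have : ∀ᶠ E in totalLengthFilter ⊓ Filter.principal (disjWithin a b), E ∈ disjWithin a b :=
    Filter.eventually_inf_principal.mpr (by simp)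
  filter_upwards [this] with E hE
  rw [Finset.mul_sum]
  exact Finset.sum_le_sum fun i hi => h _ (hE.1 i hi).1 _ (hE.1 i hi).2

theorem clm_comp {E F : Type*} [NormedAddCommGroup E] [NormedSpace ℝ E] [NormedAddCommGroup F]
    [NormedSpace ℝ F] {f : ℝ → E} {a b : ℝ} (L : E →L[ℝ] F)
    (hf : AbsolutelyContinuousOnInterval f a b) :
    AbsolutelyContinuousOnInterval (fun x => L (f x)) a b := by
  refine hf.of_dist_le (C := ‖L‖) fun x _ y _ => ?_
  rw [dist_eq_norm, dist_eq_norm, ← map_sub]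
  exact L.le_opNorm _

/-- The increments are dominated by those of the real primitive of `‖f‖`. -/
theorem intervalIntegral {E : Type*} [NormedAddCommGroup E] [NormedSpace ℝ E]
    {f : ℝ → E} {a b : ℝ} (hf : IntervalIntegrable f volume a b) :
    AbsolutelyContinuousOnInterval (fun x => ∫ t in a..x, f t) a b := by
  have h := hf.norm.absolutelyContinuousOnInterval_intervalIntegral (c := a) left_mem_uIcc
  refine h.of_dist_le (C := 1) fun x hx y hy => ?_
  have hax : IntervalIntegrable f volume a x := hf.mono_set (uIcc_subset_uIcc left_mem_uIcc hx)
  have hay : IntervalIntegrable f volume a y := hf.mono_set (uIcc_subset_uIcc left_mem_uIcc hy)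
  rw [dist_eq_norm, Real.dist_eq, intervalIntegral.integral_interval_sub_left hax hay,
    intervalIntegral.integral_interval_sub_left hax.norm hay.norm, one_mul]
  exact intervalIntegral.norm_integral_le_abs_integral_norm

/-- The fundamental theorem of calculus for absolutely continuous vector-valued functions. -/
theorem eq_add_integral {E : Type*} [NormedAddCommGroup E] [NormedSpace ℝ E] [CompleteSpace E]
    {F f : ℝ → E} {a b : ℝ} (hF : AbsolutelyContinuousOnInterval F a b)
    (hf : IntervalIntegrable f volume a b) (h : ∀ᵐ x, x ∈ uIcc a b → HasDerivAt F (f x) x)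
    {x : ℝ} (hx : x ∈ uIcc a b) : F x = F a + ∫ t in a..x, f t := by
  have hg := hF.fun_sub (intervalIntegral hf)
  have h0 : ∀ᵐ x, x ∈ uIcc a b → HasDerivAt (fun x => F x - ∫ t in a..x, f t) 0 x := by
    filter_upwards [h, hf.ae_hasDerivAt_integral] with x h1 h2 hx
    simpa using (h1 hx).fun_sub (h2 hx a left_mem_uIcc)
  obtain ⟨C, hC⟩ := hg.const_of_ae_hasDerivAt_zero h0
  have h1 := hC a left_mem_uIcc
  have h2 := hC x hx
  simp only [intervalIntegral.integral_same, sub_zero] at h1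
  rw [h1, ← h2]; abel

theorem pow {f : ℝ → ℝ} {a b : ℝ} (hf : AbsolutelyContinuousOnInterval f a b) (n : ℕ) :
    AbsolutelyContinuousOnInterval (fun x => f x ^ (n + 1)) a b := by
  induction n with
  | zero => simpa using hf
  | succ n ih => simpa only [pow_succ _ (n + 1)] using ih.fun_mul hf

end AbsolutelyContinuousOnInterval

open Set in
-- The right-hand side is absolutely continuous in `x`, vanishes at `a`, and has the integrand as
-- its derivative almost everywhere, so `f` need only be integrable. This is the source of the
-- factorial in the Volterra bound.
theorem intervalIntegral_mul_pow_integral {f : ℝ → ℝ} {a b : ℝ}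
    (hf : IntervalIntegrable f volume a b) (n : ℕ) {x : ℝ} (hx : x ∈ uIcc a b) :
    ∫ t in a..x, f t * (∫ s in a..t, f s) ^ n / n.factorial =
      (∫ s in a..x, f s) ^ (n + 1) / (n + 1).factorial := by
  have hA := AbsolutelyContinuousOnInterval.intervalIntegral hf
  have hi : IntervalIntegrable (fun t => f t * (∫ s in a..t, f s) ^ n / n.factorial) volume a b :=
    (hf.mul_continuousOn (hA.continuousOn.pow n)).div_const _
  have h := ((hA.pow n).const_mul (((n + 1).factorial : ℝ)⁻¹)).eq_add_integral hi ?_ hx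
  · simp only [intervalIntegral.integral_same] at h
    rw [div_eq_inv_mul, h]; simp
  · filter_upwards [hf.ae_hasDerivAt_integral] with t ht h
    convert! ((ht h a left_mem_uIcc).fun_pow (n + 1)).const_mul (((n + 1).factorial : ℝ)⁻¹) using 1
    rw [Nat.factorial_succ]
    have : (n.factorial : ℝ) ≠ 0 := by positivity
    push_cast
    field_simp

/-! ### Volterra operators -/

/-- Inversion is differentiable at every unit of a Banach algebra and is composed here with an
affine function of `z`. -/
theorem differentiable_inverse_one_sub_add_smul {X : Type*} [NormedAddCommGroup X]
    [NormedSpace ℂ X] [CompleteSpace X] (K₀ K₁ : X →L[ℂ] X)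
    (h : ∀ z : ℂ, IsUnit (1 - (K₀ + z • K₁))) :
    Differentiable ℂ fun z : ℂ => Ring.inverse (1 - (K₀ + z • K₁)) := by
  intro z
  have h1 : DifferentiableAt ℂ (fun z : ℂ => 1 - (K₀ + z • K₁)) z := by fun_prop
  exact (differentiableAt_inverse (h z)).comp z h1

section Volterra

variable {E : Type*} [NormedAddCommGroup E] [NormedSpace ℂ E] {a b : ℝ}

open Set

/-- The primitive of an integrable function, vanishing at the left end point. -/
def primitive (hab : a ≤ b) (f : ℝ → E) (hf : IntervalIntegrable f volume a b) : C(Icc a b, E) where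
  toFun x := ∫ t in a..x, f t
  continuous_toFun := by
    have h := (AbsolutelyContinuousOnInterval.intervalIntegral hf).continuousOn
    rw [uIcc_of_le hab] at h
    exact h.comp_continuous continuous_subtype_val fun x => x.2

theorem intervalIntegrable_apply_IccExtend (hab : a ≤ b) {N : ℝ → E →L[ℂ] E}
    (hN : IntervalIntegrable N volume a b) (F : C(Icc a b, E)) :
    IntervalIntegrable (fun t => N t (IccExtend hab F t)) volume a b := by
  have hc : Continuous (IccExtend hab F) := F.continuous.Icc_extend'
  rw [intervalIntegrable_iff] at hN ⊢
  refine Integrable.mono' (hN.norm.mul_const ‖F‖) ?_ ?_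
  · exact (ContinuousLinearMap.id ℂ (E →L[ℂ] E)).aestronglyMeasurable_comp₂
      hN.aestronglyMeasurable hc.aestronglyMeasurable
  · refine Filter.Eventually.of_forall fun t => (N t).le_opNorm_of_le ?_
    exact F.norm_coe_le_norm _

theorem norm_integral_apply_le (hab : a ≤ b) {N : ℝ → E →L[ℂ] E}
    (hN : IntervalIntegrable N volume a b) {F : C(Icc a b, E)} {φ : ℝ → ℝ} (hφ : Continuous φ)
    (hF : ∀ t : Icc a b, ‖F t‖ ≤ φ t) {x : ℝ} (hx : x ∈ Icc a b) :
    ‖∫ t in a..x, N t (IccExtend hab F t)‖ ≤ ∫ t in a..x, ‖N t‖ * φ t := by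
  have hsub : uIcc a x ⊆ uIcc a b := by
    rw [uIcc_of_le hab, uIcc_of_le hx.1]; exact Icc_subset_Icc_right hx.2
  refine intervalIntegral.norm_integral_le_of_norm_le hx.1 (Filter.Eventually.of_forall ?_)
    ((hN.mono_set hsub).norm.mul_continuousOn hφ.continuousOn)
  intro t ht
  have ht' : t ∈ Icc a b := ⟨ht.1.le, ht.2.trans hx.2⟩
  rw [IccExtend_of_mem hab F ht']
  exact (N t).le_opNorm_of_le (hF ⟨t, ht'⟩)

/-- The Volterra operator `F ↦ ∫ₐˣ N(t) F(t) dt`. -/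
def volterra (hab : a ≤ b) (N : ℝ → E →L[ℂ] E) (hN : IntervalIntegrable N volume a b) :
    C(Icc a b, E) →L[ℂ] C(Icc a b, E) :=
  LinearMap.mkContinuous
    { toFun := fun F => primitive hab (fun t => N t (IccExtend hab F t))
        (intervalIntegrable_apply_IccExtend hab hN F)
      map_add' := fun F F' => by
        ext x
        have hsub : uIcc a x ⊆ uIcc a b := by
          rw [uIcc_of_le hab, uIcc_of_le x.2.1]; exact Icc_subset_Icc_right x.2.2
        have h := (intervalIntegrable_apply_IccExtend hab hN F).mono_set hsub
        have h' := (intervalIntegrable_apply_IccExtend hab hN F').mono_set hsub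
        refine Eq.trans ?_ (intervalIntegral.integral_add h h')
        exact intervalIntegral.integral_congr fun t _ => map_add (N t) _ _
      map_smul' := fun c F => by
        ext x
        refine Eq.trans ?_ (intervalIntegral.integral_smul c _)
        exact intervalIntegral.integral_congr fun t _ => map_smul (N t) _ _ }
    (∫ t in a..b, ‖N t‖) fun F => by
      have h0 : 0 ≤ ∫ t in a..b, ‖N t‖ :=
        intervalIntegral.integral_nonneg hab fun _ _ => norm_nonneg _
      rw [ContinuousMap.norm_le _ (by positivity)]
      intro x
      refine (norm_integral_apply_le hab hN (F := F) (φ := fun _ => ‖F‖) continuous_const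
        (fun t => F.norm_coe_le_norm t) x.2).trans ?_
      rw [intervalIntegral.integral_mul_const]
      refine mul_le_mul_of_nonneg_right ?_ (norm_nonneg _)
      exact intervalIntegral.integral_mono_interval le_rfl x.2.1 x.2.2
        (Filter.Eventually.of_forall fun _ => norm_nonneg _) hN.norm

theorem volterra_apply (hab : a ≤ b) {N : ℝ → E →L[ℂ] E} (hN : IntervalIntegrable N volume a b)
    (F : C(Icc a b, E)) (x : Icc a b) :
    volterra hab N hN F x = ∫ t in a..x, N t (IccExtend hab F t) := rfl

/-- The bound is pointwise in `x`, not merely uniform, so that it can be integrated again in the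
induction step. -/
theorem norm_volterra_pow_apply_le (hab : a ≤ b) {N : ℝ → E →L[ℂ] E}
    (hN : IntervalIntegrable N volume a b) (n : ℕ) (F : C(Icc a b, E)) (x : Icc a b) :
    ‖(volterra hab N hN ^ n) F x‖ ≤ (∫ t in a..x, ‖N t‖) ^ n / n.factorial * ‖F‖ := by
  induction n generalizing x with
  | zero => simpa using F.norm_coe_le_norm x
  | succ n ih =>
    rw [pow_succ', mul_apply_eq_comp, volterra_apply]
    have hA := (AbsolutelyContinuousOnInterval.intervalIntegral hN.norm).continuousOn
    rw [uIcc_of_le hab] at hA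
    -- The integral estimate needs a majorant continuous on the whole line; the primitive is
    -- therefore extended by constants.
    have hAc : Continuous (IccExtend hab (fun t : Icc a b => ∫ s in a..t, ‖N s‖)) :=
      (hA.comp_continuous continuous_subtype_val fun x => x.2).Icc_extend'
    have key := norm_integral_apply_le hab hN (F := (volterra hab N hN ^ n) F)
      (φ := fun t => (IccExtend hab (fun t : Icc a b => ∫ s in a..t, ‖N s‖) t) ^ n / n.factorial
        * ‖F‖) (by fun_prop) (fun t => by rw [IccExtend_val]; exact ih t) x.2
    refine key.trans (le_of_eq ?_)
    rw [← intervalIntegral_mul_pow_integral hN.norm n (by rw [uIcc_of_le hab]; exact x.2),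
      ← intervalIntegral.integral_mul_const]
    refine intervalIntegral.integral_congr fun t ht => ?_
    rw [uIcc_of_le x.2.1] at ht
    have ht' : t ∈ Icc a b := ⟨ht.1, ht.2.trans x.2.2⟩
    simp only [IccExtend_of_mem hab _ ht']
    ring

/-- A Volterra operator is quasinilpotent, so the Volterra integral equation is solvable. -/
theorem isUnit_one_sub_volterra (hab : a ≤ b) [CompleteSpace E] {N : ℝ → E →L[ℂ] E}
    (hN : IntervalIntegrable N volume a b) : IsUnit (1 - volterra hab N hN) := by
  set K := volterra hab N hN
  set A := ∫ t in a..b, ‖N t‖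
  have hA : 0 ≤ A := intervalIntegral.integral_nonneg hab fun _ _ => norm_nonneg _
  have hlim := FloorSemiring.tendsto_pow_div_factorial_atTop A
  obtain ⟨n, hn⟩ := (hlim.eventually_lt_const one_pos).exists
  have hK : ‖K ^ n‖ < 1 := by
    refine lt_of_le_of_lt (ContinuousLinearMap.opNorm_le_bound _ (by positivity) fun F => ?_) hn
    rw [ContinuousMap.norm_le _ (by positivity)]
    intro x
    refine (norm_volterra_pow_apply_le hab hN n F x).trans ?_
    have h0 : 0 ≤ ∫ t in a..x, ‖N t‖ :=
      intervalIntegral.integral_nonneg x.2.1 fun _ _ => norm_nonneg _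
    have h1 : ∫ t in a..x, ‖N t‖ ≤ A := intervalIntegral.integral_mono_interval le_rfl x.2.1 x.2.2
        (Filter.Eventually.of_forall fun _ => norm_nonneg _) hN.norm
    gcongr
  -- Only a power of `K` is a contraction; `1 - K` inherits invertibility as a commuting factor of
  -- `1 - K ^ n`.
  have hu : IsUnit (1 - K ^ n) :=
    isUnit_one_sub_of_norm_lt_one (R := C(Icc a b, E) →L[ℂ] C(Icc a b, E)) (x := K ^ n) hK
  rw [← mul_neg_geom_sum] at hu
  have hc : Commute (1 - K) (∑ i ∈ Finset.range n, K ^ i) :=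
    (Commute.one_left _).sub_left
      (Commute.sum_right _ _ _ fun i _ => (Commute.refl K).pow_right i)
  exact (hc.isUnit_mul_iff.1 hu).1

/-- Affine dependence on `z` is what makes the solution operator an entire function of `z`. -/
theorem volterra_add_smul (hab : a ≤ b) {N : ℝ → E →L[ℂ] E} (hN : IntervalIntegrable N volume a b)
    (A : E →L[ℂ] E) (z : ℂ) (hz : IntervalIntegrable (fun t => N t + z • A) volume a b) :
    volterra hab (fun t => N t + z • A) hz =
      volterra hab N hN + z • volterra hab (fun _ => A) intervalIntegrable_const := by
  ext F x
  have hsub : uIcc a x ⊆ uIcc a b := by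
    rw [uIcc_of_le hab, uIcc_of_le x.2.1]; exact Icc_subset_Icc_right x.2.2
  have h0 := (intervalIntegrable_apply_IccExtend hab hN F).mono_set hsub
  have h1 := (intervalIntegrable_apply_IccExtend hab (N := fun _ => A)
    intervalIntegrable_const F).mono_set hsub
  simp only [add_apply, smul_apply, ContinuousMap.add_apply, ContinuousMap.smul_apply,
    volterra_apply]
  rw [← intervalIntegral.integral_smul]
  exact intervalIntegral.integral_add h0 (h1.smul z)

theorem differentiable_inverse_one_sub_volterra (hab : a ≤ b) [CompleteSpace E]
    {N : ℝ → E →L[ℂ] E} (hN : IntervalIntegrable N volume a b) (A : E →L[ℂ] E)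
    (hz : ∀ z : ℂ, IntervalIntegrable (fun t => N t + z • A) volume a b) :
    Differentiable ℂ fun z => Ring.inverse (1 - volterra hab (fun t => N t + z • A) (hz z)) := by
  simp_rw [volterra_add_smul hab hN]
  exact differentiable_inverse_one_sub_add_smul _ _ fun z =>
    volterra_add_smul hab hN A z (hz z) ▸ isUnit_one_sub_volterra hab (hz z)

end Volterra

end

noncomputable section

namespace DiracKrein

/-! ### The first-order system on an edge and its solution operator -/

theorem J_mulVec (u : Fin 2 → ℂ) : J *ᵥ u = ![-u 1, u 0] := by
  ext i; fin_cases i <;> simp [J, Matrix.mulVec, dotProduct]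

theorem J_mul_J : J * J = -1 := by
  ext i k; fin_cases i <;> fin_cases k <;> simp [J, Matrix.mul_apply]

theorem J_mulVec_J_mulVec (u : Fin 2 → ℂ) : J *ᵥ (J *ᵥ u) = -u := by
  rw [Matrix.mulVec_mulVec, J_mul_J, Matrix.neg_mulVec, Matrix.one_mulVec]

/-- The continuous linear map `u ↦ A u` on `ℂ²`. -/
def mulVecCLM (A : Matrix (Fin 2) (Fin 2) ℂ) : (Fin 2 → ℂ) →L[ℂ] (Fin 2 → ℂ) :=
  LinearMap.toContinuousLinearMap A.mulVecLin

@[simp]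
theorem mulVecCLM_apply (A : Matrix (Fin 2) (Fin 2) ℂ) (u : Fin 2 → ℂ) :
    mulVecCLM A u = A *ᵥ u := rfl

namespace StarGraph

variable {n : ℕ} (G : StarGraph n)

theorem v_le_w (j : Fin n) : G.v ≤ G.w j := (G.v_lt_w j).le

instance (j : Fin n) : IsFiniteMeasure (G.μ j) := by unfold μ; infer_instance

theorem intervalIntegrable_iff_integrable {E : Type*} [NormedAddCommGroup E] {j : Fin n}
    {f : ℝ → E} : IntervalIntegrable f volume G.v (G.w j) ↔ Integrable f (G.μ j) :=
  intervalIntegrable_iff_integrableOn_Icc_of_le (G.v_le_w j)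

theorem ae_edge_iff {j : Fin n} {P : ℝ → Prop} :
    (∀ᵐ x ∂(G.μ j), P x) ↔ ∀ᵐ x, x ∈ Set.uIcc G.v (G.w j) → P x := by
  rw [Set.uIcc_of_le (G.v_le_w j), μ, ae_restrict_iff' measurableSet_Icc]

/-- The potential part of the coefficient of the first order system below. -/
def potential (j : Fin n) (x : ℝ) : (Fin 2 → ℂ) →L[ℂ] (Fin 2 → ℂ) :=
  (G.p j x : ℂ) • mulVecCLM (J * !![-1, 0; 0, 1]) + (G.q j x : ℂ) • mulVecCLM (J * !![0, -1; -1, 0])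

/-- The coefficient of the first order system `F' = J (z - V) F + J g` equivalent to
`H F = z F + g`. -/
def coeff (j : Fin n) (z : ℂ) (x : ℝ) : (Fin 2 → ℂ) →L[ℂ] (Fin 2 → ℂ) :=
  G.potential j x + z • mulVecCLM J

theorem coeff_apply (j : Fin n) (z : ℂ) (x : ℝ) (u : Fin 2 → ℂ) :
    G.coeff j z x u = J *ᵥ (z • u - G.V j x *ᵥ u) := by
  ext i
  fin_cases i <;> simp [coeff, potential, V, J, Matrix.mulVec, dotProduct] <;> ring

theorem intervalIntegrable_potential (j : Fin n) :
    IntervalIntegrable (G.potential j) volume G.v (G.w j) := by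
  rw [G.intervalIntegrable_iff_integrable]
  exact ((G.p_integrable j).ofReal.smul_const _).add ((G.q_integrable j).ofReal.smul_const _)

theorem intervalIntegrable_coeff (j : Fin n) (z : ℂ) :
    IntervalIntegrable (G.coeff j z) volume G.v (G.w j) :=
  (G.intervalIntegrable_potential j).add intervalIntegrable_const

/-- Since `J² = -1`, multiplication by `J` solves the equation for the derivative. -/
theorem diracExpr_eq_iff (j : Fin n) (z : ℂ) (F : ℝ → Fin 2 → ℂ) (x : ℝ) (g : Fin 2 → ℂ) :
    G.diracExpr j F x = z • F x + g ↔ deriv F x = G.coeff j z x (F x) + J *ᵥ g := by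
  rw [coeff_apply, ← Matrix.mulVec_add, diracExpr]
  constructor
  · intro h
    have : z • F x - G.V j x *ᵥ F x + g = -(J *ᵥ deriv F x) := by
      rw [sub_add_eq_add_sub, ← h]; abel
    rw [this, Matrix.mulVec_neg, J_mulVec_J_mulVec, neg_neg]
  · intro h
    rw [h, J_mulVec_J_mulVec]; abel

/-- The space of continuous `ℂ²`-valued functions on the edge `e_j`. -/
abbrev EdgeC (j : Fin n) : Type := C(Set.Icc G.v (G.w j), Fin 2 → ℂ)

/-- The Volterra operator of the system on the edge `e_j`. -/
def edgeVolterra (j : Fin n) (z : ℂ) : G.EdgeC j →L[ℂ] G.EdgeC j :=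
  volterra (G.v_le_w j) (G.coeff j z) (G.intervalIntegrable_coeff j z)

/-- The solution operator of the integral equation `F - K F = h` on the edge `e_j`. -/
def solOp (j : Fin n) (z : ℂ) : G.EdgeC j →L[ℂ] G.EdgeC j :=
  Ring.inverse (1 - G.edgeVolterra j z)

theorem isUnit_one_sub_edgeVolterra (j : Fin n) (z : ℂ) : IsUnit (1 - G.edgeVolterra j z) :=
  isUnit_one_sub_volterra (G.v_le_w j) (G.intervalIntegrable_coeff j z)

theorem solOp_eq_iff (j : Fin n) (z : ℂ) (F h : G.EdgeC j) :
    F = G.solOp j z h ↔ F = h + G.edgeVolterra j z F := by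
  have h1 := Ring.inverse_mul_cancel _ (G.isUnit_one_sub_edgeVolterra j z)
  have h2 := Ring.mul_inverse_cancel _ (G.isUnit_one_sub_edgeVolterra j z)
  constructor
  · intro hF
    have := DFunLike.congr_fun h2 h
    rw [mul_apply_eq_comp] at this
    change (1 - G.edgeVolterra j z) (G.solOp j z h) = h at this
    rw [← hF] at this
    have e : F - G.edgeVolterra j z F = h := this
    rw [← e]; abel
  · intro hF
    have := DFunLike.congr_fun h1 F
    rw [mul_apply_eq_comp] at this
    have e : (1 - G.edgeVolterra j z) F = h := by
      change F - G.edgeVolterra j z F = h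
      nth_rewrite 1 [hF]; abel
    rw [e] at this
    exact this.symm

theorem differentiable_solOp (j : Fin n) : Differentiable ℂ (G.solOp j) :=
  differentiable_inverse_one_sub_volterra (G.v_le_w j) (G.intervalIntegrable_potential j)
    (mulVecCLM J) (G.intervalIntegrable_coeff j)

theorem intervalIntegrable_J_mulVec {j : Fin n} {g : ℝ → Fin 2 → ℂ}
    (hg : IntervalIntegrable g volume G.v (G.w j)) :
    IntervalIntegrable (fun t => J *ᵥ g t) volume G.v (G.w j) := by
  rw [G.intervalIntegrable_iff_integrable] at hg ⊢
  exact (mulVecCLM J).integrable_comp hg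

/-- The continuous function `u + ∫ᵥˣ J g`. -/
def source (j : Fin n) (u : Fin 2 → ℂ) (g : ℝ → Fin 2 → ℂ)
    (hg : IntervalIntegrable g volume G.v (G.w j)) : G.EdgeC j :=
  ContinuousMap.const _ u + primitive (G.v_le_w j) _ (G.intervalIntegrable_J_mulVec hg)

/-- An absolutely continuous solution of `H F = z F + g` is given by the solution operator. -/
theorem eq_solOp {j : Fin n} {z : ℂ} {F g : ℝ → Fin 2 → ℂ}
    (hF : AbsolutelyContinuousOnInterval F G.v (G.w j))
    (hg : IntervalIntegrable g volume G.v (G.w j))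
    (h : ∀ᵐ x ∂(G.μ j), G.diracExpr j F x = z • F x + g x) (x : Set.Icc G.v (G.w j)) :
    F x = G.solOp j z (G.source j (F G.v) g hg) x := by
  have hc := hF.continuousOn
  rw [Set.uIcc_of_le (G.v_le_w j)] at hc
  let Φ : G.EdgeC j := ⟨fun x => F x, hc.comp_continuous continuous_subtype_val fun x => x.2⟩
  have hi := (intervalIntegrable_apply_IccExtend (G.v_le_w j)
    (G.intervalIntegrable_coeff j z) Φ)
  have hJ := G.intervalIntegrable_J_mulVec hg
  have key : ∀ x ∈ Set.uIcc G.v (G.w j), F x = F G.v +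
      ∫ t in G.v..x, (G.coeff j z t (Set.IccExtend (G.v_le_w j) Φ t) + J *ᵥ g t) := by
    intro x hx
    refine hF.eq_add_integral (hi.add hJ) ?_ hx
    rw [← G.ae_edge_iff]
    have hm : ∀ᵐ x ∂(G.μ j), x ∈ Set.Icc G.v (G.w j) := ae_restrict_mem measurableSet_Icc
    filter_upwards [h, G.ae_differentiableAt_of_absCont hF, hm] with x h1 h2 h3
    rw [diracExpr_eq_iff] at h1
    rw [Set.IccExtend_of_mem _ _ h3]
    change HasDerivAt F (G.coeff j z x (F x) + J *ᵥ g x) x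
    rw [← h1]
    exact h2.hasDerivAt
  suffices hΦ : Φ = G.solOp j z (G.source j (F G.v) g hg) from DFunLike.congr_fun hΦ x
  rw [solOp_eq_iff]
  ext1 x
  have hx : (x : ℝ) ∈ Set.uIcc G.v (G.w j) := by rw [Set.uIcc_of_le (G.v_le_w j)]; exact x.2
  have hsub := Set.uIcc_subset_uIcc (Set.left_mem_uIcc (a := G.v) (b := G.w j)) hx
  change F x = F G.v + (∫ t in G.v..x, J *ᵥ g t) + ∫ t in G.v..x, _
  rw [key x hx, intervalIntegral.integral_add (hi.mono_set hsub) (hJ.mono_set hsub)]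
  abel

section Existence

variable (j : Fin n) (z : ℂ) (u : Fin 2 → ℂ) (g : ℝ → Fin 2 → ℂ)
  (hg : IntervalIntegrable g volume G.v (G.w j))

/-- The solution of `H F = z F + g`, `F(v) = u`, on the edge `e_j`. -/
def solution : ℝ → Fin 2 → ℂ :=
  Set.IccExtend (G.v_le_w j) (G.solOp j z (G.source j u g hg))

theorem solution_eq {x : ℝ} (hx : x ∈ Set.uIcc G.v (G.w j)) :
    G.solution j z u g hg x = u +
      ∫ t in G.v..x, (G.coeff j z t (G.solution j z u g hg t) + J *ᵥ g t) := by
  have hi := (intervalIntegrable_apply_IccExtend (G.v_le_w j)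
    (G.intervalIntegrable_coeff j z) (G.solOp j z (G.source j u g hg)))
  have hJ := G.intervalIntegrable_J_mulVec hg
  have hsub := Set.uIcc_subset_uIcc (Set.left_mem_uIcc (a := G.v) (b := G.w j)) hx
  have hx' := hx
  rw [Set.uIcc_of_le (G.v_le_w j)] at hx'
  have h := DFunLike.congr_fun ((G.solOp_eq_iff j z _ (G.source j u g hg)).1 rfl) ⟨x, hx'⟩
  unfold solution
  rw [intervalIntegral.integral_add (hi.mono_set hsub) (hJ.mono_set hsub),
    Set.IccExtend_of_mem _ _ hx', h]
  change u + (∫ t in G.v..x, J *ᵥ g t) + (∫ t in G.v..x, _) = _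
  rw [add_assoc, add_comm (∫ t in G.v..x, J *ᵥ g t)]

theorem intervalIntegrable_solution_deriv : IntervalIntegrable
    (fun t => G.coeff j z t (G.solution j z u g hg t) + J *ᵥ g t) volume G.v (G.w j) :=
  (intervalIntegrable_apply_IccExtend (G.v_le_w j) (G.intervalIntegrable_coeff j z) _).add
    (G.intervalIntegrable_J_mulVec hg)

theorem solution_left : G.solution j z u g hg G.v = u := by
  rw [G.solution_eq j z u g hg Set.left_mem_uIcc]; simp

theorem solution_absCont :
    AbsolutelyContinuousOnInterval (G.solution j z u g hg) G.v (G.w j) := by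
  have h0 : AbsolutelyContinuousOnInterval (fun _ : ℝ => u) G.v (G.w j) := by
    simp [AbsolutelyContinuousOnInterval, tendsto_const_nhds]
  exact (h0.fun_add (AbsolutelyContinuousOnInterval.intervalIntegral
    (G.intervalIntegrable_solution_deriv j z u g hg))).congr
    fun x hx => (G.solution_eq j z u g hg hx).symm

theorem solution_eqn : ∀ᵐ x ∂(G.μ j), G.diracExpr j (G.solution j z u g hg) x =
    z • G.solution j z u g hg x + g x := by
  have h := (G.intervalIntegrable_solution_deriv j z u g hg).ae_hasDerivAt_integral
  -- The integral equation holds only on the closed edge, so it can be differentiated only at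
  -- interior points; the two end points form a null set.
  have h1 : ∀ᵐ x : ℝ, x ≠ G.v := by simp [ae_iff]
  have h2 : ∀ᵐ x : ℝ, x ≠ G.w j := by simp [ae_iff]
  rw [ae_edge_iff]
  filter_upwards [h, h1, h2] with x hx hx1 hx2 hxm
  rw [diracExpr_eq_iff]
  have hd := (hx hxm _ Set.left_mem_uIcc).const_add u
  refine HasDerivAt.deriv (hd.congr_of_eventuallyEq ?_)
  rw [Set.uIcc_of_le (G.v_le_w j)] at hxm
  filter_upwards [Icc_mem_nhds (lt_of_le_of_ne hxm.1 (Ne.symm hx1)) (lt_of_le_of_ne hxm.2 hx2)]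
    with y hy
  exact G.solution_eq j z u g hg (by rwa [Set.uIcc_of_le (G.v_le_w j)])

end Existence

/-! ### Fundamental matrices -/

theorem exists_isFundamentalMatrix (j : Fin n) (z : ℂ) : ∃ Y, G.IsFundamentalMatrix j z Y := by
  refine ⟨fun x => Matrix.of fun i l => G.solution j z (Pi.single l 1) (fun _ => 0)
    intervalIntegrable_const x i, ⟨fun l => G.solution_absCont j z _ _ _, fun l => ?_, ?_⟩⟩
  · filter_upwards [G.solution_eqn j z (Pi.single l 1) (fun _ => 0)
      intervalIntegrable_const] with x hx
    rw [add_zero] at hx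
    exact hx
  · ext i l
    simp [solution_left, Matrix.one_apply, Pi.single_apply]

theorem isFundamentalMatrix_Y (j : Fin n) (z : ℂ) : G.IsFundamentalMatrix j z (G.Y j z) := by
  rw [Y, dif_pos (G.exists_isFundamentalMatrix j z)]
  exact (G.exists_isFundamentalMatrix j z).choose_spec

theorem Y_left (j : Fin n) (z : ℂ) : G.Y j z G.v = 1 := (G.isFundamentalMatrix_Y j z).initial

theorem Y_mulVec_eq (j : Fin n) (z : ℂ) (u : Fin 2 → ℂ) (x : ℝ) :
    G.Y j z x *ᵥ u = u 0 • (G.Y j z x).col 0 + u 1 • (G.Y j z x).col 1 := by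
  ext i
  simp [Matrix.mulVec, dotProduct, Matrix.col_apply]
  ring

theorem Y_mulVec_absCont (j : Fin n) (z : ℂ) (u : Fin 2 → ℂ) :
    AbsolutelyContinuousOnInterval (fun x => G.Y j z x *ᵥ u) G.v (G.w j) := by
  simp_rw [Y_mulVec_eq]
  exact (((G.isFundamentalMatrix_Y j z).absCont 0).const_smul (u 0)).fun_add
    (((G.isFundamentalMatrix_Y j z).absCont 1).const_smul (u 1))

theorem Y_mulVec_eqn (j : Fin n) (z : ℂ) (u : Fin 2 → ℂ) :
    ∀ᵐ x ∂(G.μ j), G.diracExpr j (fun x => G.Y j z x *ᵥ u) x = z • (G.Y j z x *ᵥ u) := by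
  have hY := G.isFundamentalMatrix_Y j z
  filter_upwards [hY.eqn 0, hY.eqn 1, G.ae_differentiableAt_of_absCont (hY.absCont 0),
    G.ae_differentiableAt_of_absCont (hY.absCont 1)] with x h0 h1 d0 d1
  simp only [diracExpr] at h0 h1 ⊢
  have hd : deriv (fun x => G.Y j z x *ᵥ u) x =
      u 0 • deriv (fun y => (G.Y j z y).col 0) x + u 1 • deriv (fun y => (G.Y j z y).col 1) x := by
    simp_rw [Y_mulVec_eq]
    exact ((d0.hasDerivAt.const_smul (u 0)).add (d1.hasDerivAt.const_smul (u 1))).deriv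
  rw [hd, Y_mulVec_eq, smul_add, smul_comm z (u 0), smul_comm z (u 1), ← h0, ← h1]
  simp only [Matrix.mulVec_add, Matrix.mulVec_smul, smul_add, smul_neg]
  abel

/-- The matrix `Y j z` is chosen separately for each `z`; uniqueness identifies it on the edge with
the solution operator applied to constants, and holomorphy in `z` follows from there. -/
theorem Y_mulVec_eq_solOp (j : Fin n) (z : ℂ) (u : Fin 2 → ℂ) (x : Set.Icc G.v (G.w j)) :
    G.Y j z x *ᵥ u = G.solOp j z (ContinuousMap.const _ u) x := by
  have h := G.eq_solOp (g := fun _ => 0) (G.Y_mulVec_absCont j z u) intervalIntegrable_const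
    (z := z) (by simpa only [add_zero] using G.Y_mulVec_eqn j z u) x
  rw [h]
  congr 2
  ext y
  simp [source, primitive, Y_left]

/-- Conjugation of a solution, for real potentials. -/
theorem conj_Y (j : Fin n) (z : ℂ) {x : ℝ} (hx : x ∈ Set.Icc G.v (G.w j)) :
    G.Y j (conj z) x = (G.Y j z x).map conj := by
  have key : ∀ l, ∀ x : Set.Icc G.v (G.w j),
      (fun i => conj ((G.Y j z x).col l i)) = G.Y j (conj z) x *ᵥ (Pi.single l 1) := by
    intro l x
    have hY := G.isFundamentalMatrix_Y j z
    -- Conjugation is only real-linear, which suffices to commute with `d/dx`. It also commutes with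
    -- `J` and `V`, whose entries are real.
    let C : (Fin 2 → ℂ) →L[ℝ] (Fin 2 → ℂ) :=
      ContinuousLinearMap.pi fun i => Complex.conjCLE.toContinuousLinearMap.comp
        (ContinuousLinearMap.proj i)
    have hac := (hY.absCont l).clm_comp C
    have h := G.eq_solOp (g := fun _ => 0) (z := conj z) hac intervalIntegrable_const ?_ x
    · rw [Y_mulVec_eq_solOp]
      refine h.trans ?_
      congr 2
      ext y i
      simp [source, primitive, Y_left, C, Matrix.col_apply, Matrix.one_apply, Pi.single_apply]
    · filter_upwards [hY.eqn l, G.ae_differentiableAt_of_absCont (hY.absCont l)] with y h1 h2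
      have hd : deriv (fun x => C ((G.Y j z x).col l)) y =
          C (deriv (fun x => (G.Y j z x).col l) y) :=
        (C.hasFDerivAt.comp_hasDerivAt y h2.hasDerivAt).deriv
      have h1' := congrArg C h1
      rw [add_zero]
      simp only [diracExpr] at h1' ⊢
      rw [hd]
      have hs : ∀ u, C (z • u) = conj z • C u := fun u => by ext i; simp [C]
      rw [← hs, ← h1']
      ext i
      fin_cases i <;> simp [C, J, V, dotProduct]
  ext i l
  have := congrFun (key l ⟨x, hx⟩) i
  simp at this
  simp [this]

/-! ### Square integrable functions on an edge -/

theorem integrable_ofLp {j : Fin n} (g : G.EdgeL2 j) :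
    Integrable (fun x => WithLp.ofLp (g x)) (G.μ j) :=
  (PiLp.continuousLinearEquiv 2 ℂ fun _ : Fin 2 => ℂ).toContinuousLinearMap.integrable_comp
    ((Lp.memLp g).integrable one_le_two)

theorem intervalIntegrable_ofLp {j : Fin n} (g : G.EdgeL2 j) :
    IntervalIntegrable (fun x => WithLp.ofLp (g x)) volume G.v (G.w j) :=
  G.intervalIntegrable_iff_integrable.2 (G.integrable_ofLp g)

theorem intervalIntegral_congr_edge {E : Type*} [NormedAddCommGroup E] [NormedSpace ℝ E] {j : Fin n}
    {f g : ℝ → E} (h : ∀ᵐ t ∂(G.μ j), f t = g t) (x : Set.Icc G.v (G.w j)) :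
    ∫ t in G.v..x, f t = ∫ t in G.v..x, g t := by
  refine intervalIntegral.integral_congr_ae ?_
  rw [ae_edge_iff] at h
  filter_upwards [h] with t ht htx
  refine ht ?_
  rw [Set.uIoc_of_le x.2.1] at htx
  rw [Set.uIcc_of_le (G.v_le_w j)]
  exact ⟨htx.1.le, htx.2.trans x.2.2⟩

theorem norm_J_mulVec_le (u : EuclideanSpace ℂ (Fin 2)) : ‖J *ᵥ WithLp.ofLp u‖ ≤ ‖u‖ := by
  rw [J_mulVec, pi_norm_le_iff_of_nonneg (norm_nonneg _)]
  intro i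
  fin_cases i
  · simpa using PiLp.norm_apply_le u 1
  · simpa using PiLp.norm_apply_le u 0

/-- Hölder's inequality on a finite measure space; it bounds `drive` from `L²` to the supremum norm.
-/
theorem integral_norm_le_norm {j : Fin n} (g : G.EdgeL2 j) :
    ∫ x, ‖g x‖ ∂(G.μ j) ≤ ((G.μ j Set.univ) ^ (1 / (1 : ℝ) - 1 / 2)).toReal * ‖g‖ := by
  have h := eLpNorm_le_eLpNorm_mul_rpow_measure_univ (p := 1) (q := 2) one_le_two
    (Lp.aestronglyMeasurable g)
  rw [integral_norm_eq_lintegral_enorm (Lp.aestronglyMeasurable g), ← eLpNorm_one_eq_lintegral_enorm,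
    Lp.norm_def, mul_comm, ← ENNReal.toReal_mul]
  refine ENNReal.toReal_mono (ENNReal.mul_ne_top (Lp.eLpNorm_ne_top g) ?_) (by simpa using h)
  exact ENNReal.rpow_ne_top_of_nonneg (by norm_num) (measure_ne_top _ _)

/-- The operator `g ↦ ∫ᵥˣ J g`. -/
def drive (j : Fin n) : G.EdgeL2 j →L[ℂ] G.EdgeC j :=
  LinearMap.mkContinuous
    { toFun := fun g => primitive (G.v_le_w j) _
        (G.intervalIntegrable_J_mulVec (G.intervalIntegrable_ofLp g))
      map_add' := fun g h => by
        ext1 x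
        have hsub : Set.uIcc G.v x ⊆ Set.uIcc G.v (G.w j) := by
          rw [Set.uIcc_of_le (G.v_le_w j), Set.uIcc_of_le x.2.1]
          exact Set.Icc_subset_Icc_right x.2.2
        have hg := (G.intervalIntegrable_J_mulVec (G.intervalIntegrable_ofLp g)).mono_set hsub
        have hh := (G.intervalIntegrable_J_mulVec (G.intervalIntegrable_ofLp h)).mono_set hsub
        refine Eq.trans ?_ (intervalIntegral.integral_add hg hh)
        refine G.intervalIntegral_congr_edge ?_ x
        filter_upwards [Lp.coeFn_add g h] with t ht
        rw [ht, Pi.add_apply, WithLp.ofLp_add, Matrix.mulVec_add]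
      map_smul' := fun c g => by
        ext1 x
        refine Eq.trans ?_ (intervalIntegral.integral_smul c _)
        refine G.intervalIntegral_congr_edge ?_ x
        filter_upwards [Lp.coeFn_smul c g] with t ht
        rw [ht, Pi.smul_apply, WithLp.ofLp_smul, Matrix.mulVec_smul] }
    ((G.μ j Set.univ) ^ (1 / (1 : ℝ) - 1 / 2)).toReal fun g => by
      rw [ContinuousMap.norm_le _ (by positivity)]
      intro x
      refine le_trans ?_ (G.integral_norm_le_norm g)
      have hg : IntervalIntegrable (fun t => ‖g t‖) volume G.v (G.w j) :=
        G.intervalIntegrable_iff_integrable.2 ((Lp.memLp g).integrable one_le_two).norm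
      have hsub : Set.uIcc G.v x ⊆ Set.uIcc G.v (G.w j) := by
        rw [Set.uIcc_of_le (G.v_le_w j), Set.uIcc_of_le x.2.1]
        exact Set.Icc_subset_Icc_right x.2.2
      refine (intervalIntegral.norm_integral_le_of_norm_le x.2.1
        (Filter.Eventually.of_forall fun t _ => norm_J_mulVec_le (g t))
        (hg.mono_set hsub)).trans ?_
      refine (intervalIntegral.integral_mono_interval le_rfl x.2.1 x.2.2
        (Filter.Eventually.of_forall fun _ => norm_nonneg _) hg).trans (le_of_eq ?_)
      rw [intervalIntegral.integral_of_le (G.v_le_w j), ← integral_Icc_eq_integral_Ioc]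
      rfl

theorem source_eq (j : Fin n) (u : Fin 2 → ℂ) (g : G.EdgeL2 j) :
    G.source j u _ (G.intervalIntegrable_ofLp g) = ContinuousMap.const _ u + G.drive j g := rfl

theorem memLp_IccExtend (j : Fin n) (F : G.EdgeC j) :
    MemLp (fun x => WithLp.toLp 2 (Set.IccExtend (G.v_le_w j) F x) : ℝ → EuclideanSpace ℂ (Fin 2))
      2 (G.μ j) := by
  have hc : Continuous
      (fun x => WithLp.toLp 2 (Set.IccExtend (G.v_le_w j) F x) : ℝ → EuclideanSpace ℂ (Fin 2)) :=
    (PiLp.continuous_toLp 2 (fun _ : Fin 2 => ℂ)).comp F.continuous.Icc_extend'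
  obtain ⟨K, hK⟩ := isCompact_Icc.exists_bound_of_continuousOn
    (hc.continuousOn (s := Set.Icc G.v (G.w j)))
  exact MemLp.of_bound hc.aestronglyMeasurable K ((ae_restrict_mem measurableSet_Icc).mono hK)

/-- The embedding of the continuous functions into `L²(e_j)`. -/
def embed (j : Fin n) : G.EdgeC j →L[ℂ] G.EdgeL2 j :=
  LinearMap.mkContinuous
    { toFun := fun F => (G.memLp_IccExtend j F).toLp _
      map_add' := fun F F' => by
        rw [← MemLp.toLp_add]
        rfl
      map_smul' := fun c F => by
        rw [RingHom.id_apply, ← MemLp.toLp_const_smul]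
        rfl }
    -- The second factor compares the Euclidean norm on `ℂ²` with the supremum norm used for
    -- continuous functions.
    (measureUnivNNReal (G.μ j) ^ (2 : ENNReal).toReal⁻¹ *
      ‖(PiLp.continuousLinearEquiv 2 ℂ fun _ : Fin 2 => ℂ).symm.toContinuousLinearMap‖)
    fun F => by
      rw [mul_assoc]
      refine Lp.norm_le_of_ae_bound (by positivity) ?_
      filter_upwards [(G.memLp_IccExtend j F).coeFn_toLp] with x hx
      refine (congrArg norm hx).trans_le ?_
      exact ((PiLp.continuousLinearEquiv 2 ℂ fun _ : Fin 2 => ℂ).symm.toContinuousLinearMap).le_opNorm_of_le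
        (F.norm_coe_le_norm _)

theorem embed_ae (j : Fin n) (F : G.EdgeC j) :
    ∀ᵐ x ∂(G.μ j), WithLp.ofLp (G.embed j F x) = Set.IccExtend (G.v_le_w j) F x := by
  filter_upwards [(G.memLp_IccExtend j F).coeFn_toLp] with x hx
  exact congrArg WithLp.ofLp hx

theorem eq_embed {j : Fin n} {f : G.EdgeL2 j} {F : ℝ → Fin 2 → ℂ} {Φ : G.EdgeC j}
    (hf : ∀ᵐ x ∂(G.μ j), WithLp.ofLp (f x) = F x) (h : ∀ x : Set.Icc G.v (G.w j), F x = Φ x) :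
    f = G.embed j Φ := by
  refine Lp.ext ?_
  have hm : ∀ᵐ x ∂(G.μ j), x ∈ Set.Icc G.v (G.w j) := ae_restrict_mem measurableSet_Icc
  filter_upwards [hf, G.embed_ae j Φ, hm] with x h1 h2 h3
  refine WithLp.ofLp_injective 2 ?_
  rw [h1, h2, Set.IccExtend_of_mem _ _ h3]
  exact h ⟨x, h3⟩

/-! ### Green's identity on an edge -/

/-- The form `a* J b` on `ℂ²`. -/
def wedge (a b : Fin 2 → ℂ) : ℂ := conj (a 1) * b 0 - conj (a 0) * b 1

/-- The function `wedge H F` is absolutely continuous with derivative minus the integrand: the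
potential terms cancel because `V` is real and symmetric. -/
theorem green {j : Fin n} {F H f h : ℝ → Fin 2 → ℂ}
    (hF : AbsolutelyContinuousOnInterval F G.v (G.w j))
    (hH : AbsolutelyContinuousOnInterval H G.v (G.w j))
    (hf : Integrable f (G.μ j)) (hh : Integrable h (G.μ j))
    (hFf : ∀ᵐ x ∂(G.μ j), G.diracExpr j F x = f x)
    (hHh : ∀ᵐ x ∂(G.μ j), G.diracExpr j H x = h x) :
    ∫ x, ((conj (H x 0) * f x 0 + conj (H x 1) * f x 1) -
        (conj (h x 0) * F x 0 + conj (h x 1) * F x 1)) ∂(G.μ j) =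
      wedge (H G.v) (F G.v) - wedge (H (G.w j)) (F (G.w j)) := by
  have hFi : ∀ i, AbsolutelyContinuousOnInterval (fun x => F x i) G.v (G.w j) := fun i =>
    hF.clm_comp (ContinuousLinearMap.proj (R := ℝ) (φ := fun _ : Fin 2 => ℂ) i)
  have hHi : ∀ i, AbsolutelyContinuousOnInterval (fun x => conj (H x i)) G.v (G.w j) := fun i =>
    hH.clm_comp (Complex.conjCLE.toContinuousLinearMap.comp
      (ContinuousLinearMap.proj (R := ℝ) (φ := fun _ : Fin 2 => ℂ) i))
  have hW : AbsolutelyContinuousOnInterval (fun x => wedge (H x) (F x)) G.v (G.w j) :=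
    ((hHi 1).fun_smul (hFi 0)).fun_sub ((hHi 0).fun_smul (hFi 1))
  have hfi : ∀ i, IntervalIntegrable (fun x => f x i) volume G.v (G.w j) := fun i =>
    G.intervalIntegrable_iff_integrable.2 (hf.eval i)
  have hhi : ∀ i, IntervalIntegrable (fun x => conj (h x i)) volume G.v (G.w j) := fun i =>
    G.intervalIntegrable_iff_integrable.2
      (Complex.conjCLE.toContinuousLinearMap.integrable_comp (hh.eval i))
  have hint : IntervalIntegrable (fun x => -((conj (H x 0) * f x 0 + conj (H x 1) * f x 1) -
        (conj (h x 0) * F x 0 + conj (h x 1) * F x 1))) volume G.v (G.w j) :=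
    ((((hfi 0).continuousOn_mul (hHi 0).continuousOn).add
      ((hfi 1).continuousOn_mul (hHi 1).continuousOn)).sub
      (((hhi 0).mul_continuousOn (hFi 0).continuousOn).add
      ((hhi 1).mul_continuousOn (hFi 1).continuousOn))).neg
  have key := hW.eq_add_integral hint ?_ Set.right_mem_uIcc
  · rw [intervalIntegral.integral_neg, intervalIntegral.integral_of_le (G.v_le_w j),
      ← integral_Icc_eq_integral_Ioc] at key
    rw [key, μ]; ring
  · rw [← G.ae_edge_iff]
    filter_upwards [hFf, hHh, G.ae_differentiableAt_of_absCont hF,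
      G.ae_differentiableAt_of_absCont hH] with x h1 h2 h3 h4
    have dF : ∀ i, HasDerivAt (fun x => F x i) (deriv F x i) x := hasDerivAt_pi.1 h3.hasDerivAt
    have dH : ∀ i, HasDerivAt (fun x => conj (H x i)) (conj (deriv H x i)) x := fun i =>
      Complex.conjCLE.toContinuousLinearMap.hasFDerivAt.comp_hasDerivAt x
        (hasDerivAt_pi.1 h4.hasDerivAt i)
    have d := ((dH 1).mul (dF 0)).sub ((dH 0).mul (dF 1))
    refine d.congr_deriv ?_
    rw [← h1, ← h2, diracExpr, diracExpr, J_mulVec, J_mulVec]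
    simp [V, Matrix.vecHead, Matrix.vecTail]
    ring

theorem integrable_of_absCont {j : Fin n} {F : ℝ → Fin 2 → ℂ}
    (hF : AbsolutelyContinuousOnInterval F G.v (G.w j)) : Integrable F (G.μ j) := by
  rw [← G.intervalIntegrable_iff_integrable]
  exact hF.continuousOn.intervalIntegrable

/-- Green's identity for a column at `z` and a column at `z̄` has zero integrand, so their `wedge`
takes the same value at both ends; by `conj_Y` this value is the determinant. -/
theorem det_Y (j : Fin n) (z : ℂ) : G.Y j z (G.w j) 0 0 * G.Y j z (G.w j) 1 1 -
    G.Y j z (G.w j) 0 1 * G.Y j z (G.w j) 1 0 = 1 := by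
  have h := G.green (G.Y_mulVec_absCont j z ![1, 0]) (G.Y_mulVec_absCont j (conj z) ![0, 1])
    ((G.integrable_of_absCont (G.Y_mulVec_absCont j z ![1, 0])).smul z)
    ((G.integrable_of_absCont (G.Y_mulVec_absCont j (conj z) ![0, 1])).smul (conj z))
    (G.Y_mulVec_eqn j z _) (G.Y_mulVec_eqn j (conj z) _)
  rw [integral_eq_zero_of_ae] at h
  · simp [wedge, Y_left, Matrix.mulVec, dotProduct,
      G.conj_Y j z (Set.right_mem_Icc.2 (G.v_le_w j))] at h
    linear_combination h
  · refine Filter.Eventually.of_forall fun x => ?_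
    simp
    ring

/-- The integrals `I(g, z)` are determined by the boundary values of a solution of
`H F = z F + g`. -/
theorem edgeIntegral_eq {j : Fin n} {z : ℂ} {F : ℝ → Fin 2 → ℂ} {g : G.L2}
    (hF : AbsolutelyContinuousOnInterval F G.v (G.w j))
    (h : ∀ᵐ x ∂(G.μ j), G.diracExpr j F x = z • F x + WithLp.ofLp (g j x)) (k : Fin 2) :
    G.edgeIntegral g z (j, k) = wedge (Pi.single k 1) (F G.v) -
      (G.Y j z (G.w j) 1 k * F (G.w j) 0 - G.Y j z (G.w j) 0 k * F (G.w j) 1) := by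
  have hg := G.green hF (G.Y_mulVec_absCont j (conj z) (Pi.single k 1))
    (((G.integrable_of_absCont hF).smul z).add (G.integrable_ofLp (g j)))
    ((G.integrable_of_absCont (G.Y_mulVec_absCont j (conj z) (Pi.single k 1))).smul (conj z))
    h (G.Y_mulVec_eqn j (conj z) _)
  have e : wedge (G.Y j (conj z) (G.w j) *ᵥ Pi.single k 1) (F (G.w j)) =
      G.Y j z (G.w j) 1 k * F (G.w j) 0 - G.Y j z (G.w j) 0 k * F (G.w j) 1 := by
    simp [wedge, G.conj_Y j z (Set.right_mem_Icc.2 (G.v_le_w j))]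
  rw [e, Y_left, Matrix.one_mulVec] at hg
  rw [← hg, edgeIntegral]
  refine integral_congr_ae (μ := G.μ j) (Filter.Eventually.of_forall fun x => ?_)
  clear e hg
  fin_cases k <;> simp [Matrix.mulVec, dotProduct] <;> ring

/-- The outer boundary condition for a solution of `H F = z F + g`. -/
theorem outer_eq {j : Fin n} {z : ℂ} {F : ℝ → Fin 2 → ℂ} {g : G.L2}
    (hF : AbsolutelyContinuousOnInterval F G.v (G.w j))
    (h : ∀ᵐ x ∂(G.μ j), G.diracExpr j F x = z • F x + WithLp.ofLp (g j x)) :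
    (Real.cos (G.α j) : ℂ) * F (G.w j) 0 + (Real.sin (G.α j) : ℂ) * F (G.w j) 1 =
      G.b j z * (F G.v 0 - G.edgeIntegral g z (j, 1)) +
        G.c j z * (F G.v 1 + G.edgeIntegral g z (j, 0)) := by
  have h0 := G.edgeIntegral_eq hF h 0
  have h1 := G.edgeIntegral_eq hF h 1
  have hd := G.det_Y j z
  simp [wedge] at h0 h1
  rw [h0, h1, b, c]
  linear_combination (-((Real.cos (G.α j) : ℂ) * F (G.w j) 0 +
    (Real.sin (G.α j) : ℂ) * F (G.w j) 1)) * hd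

/-- The row `(b, c)` is the nonzero row `(cos α, sin α)` times `Y(w)`, which has determinant `1`. -/
theorem b_c_ne_zero (j : Fin n) (z : ℂ) : G.b j z ≠ 0 ∨ G.c j z ≠ 0 := by
  by_contra! h
  have hd := G.det_Y j z
  obtain ⟨hb, hc⟩ := h
  rw [b] at hb
  rw [c] at hc
  have h1 : (Real.cos (G.α j) : ℂ) = 0 := by
    linear_combination (-Real.cos (G.α j) : ℂ) * hd + G.Y j z (G.w j) 1 1 * hb -
      G.Y j z (G.w j) 1 0 * hc
  have h2 : (Real.sin (G.α j) : ℂ) = 0 := by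
    linear_combination (-Real.sin (G.α j) : ℂ) * hd - G.Y j z (G.w j) 0 1 * hb +
      G.Y j z (G.w j) 0 0 * hc
  have h3 := Real.sin_sq_add_cos_sq (G.α j)
  norm_cast at h1 h2
  rw [h1, h2] at h3
  norm_num at h3

theorem b_conj (j : Fin n) (z : ℂ) : G.b j (conj z) = conj (G.b j z) := by
  simp [b, G.conj_Y j z (Set.right_mem_Icc.2 (G.v_le_w j)), Complex.conj_ofReal,
    ← Complex.cos_conj, ← Complex.sin_conj]

theorem c_conj (j : Fin n) (z : ℂ) : G.c j (conj z) = conj (G.c j z) := by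
  simp [c, G.conj_Y j z (Set.right_mem_Icc.2 (G.v_le_w j)), Complex.conj_ofReal,
    ← Complex.cos_conj, ← Complex.sin_conj]

theorem m_conj (j : Fin n) (z : ℂ) : G.m j (conj z) = conj (G.m j z) := by
  rw [m, m, b_conj, c_conj, map_div₀]

end StarGraph

/-! ### Holomorphic families of operators -/

section Differentiability

variable {X Y H : Type*} [NormedAddCommGroup X] [NormedSpace ℂ X] [NormedAddCommGroup Y]
  [NormedSpace ℂ Y] [NormedAddCommGroup H] [NormedSpace ℂ H]

theorem differentiable_comp_comp {S : ℂ → X →L[ℂ] X} (hS : Differentiable ℂ S) (A : X →L[ℂ] Y)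
    (B : H →L[ℂ] X) : Differentiable ℂ fun z => A ∘L S z ∘L B :=
  (differentiable_const A).clm_comp (hS.clm_comp (differentiable_const B))

theorem differentiable_comp_apply {S : ℂ → X →L[ℂ] X} (hS : Differentiable ℂ S) (A : X →L[ℂ] Y)
    (x : X) : Differentiable ℂ fun z => A (S z x) :=
  A.differentiable.comp (hS.clm_apply (differentiable_const x))

end Differentiability

namespace StarGraph

variable {n : ℕ} (G : StarGraph n)

/-! ### Edge functions and the solution operators -/

theorem Y_mulVec_eq_solOp_toLp (j : Fin n) (z : ℂ) (u : Fin 2 → ℂ) :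
    (G.memLp_Y_mulVec j z u).toLp _ = G.embed j (G.solOp j z (ContinuousMap.const _ u)) := by
  refine G.eq_embed (F := fun x => G.Y j z x *ᵥ u) ?_ fun x => G.Y_mulVec_eq_solOp j z u x
  filter_upwards [(G.memLp_Y_mulVec j z u).coeFn_toLp] with x hx
  exact congrArg WithLp.ofLp hx

theorem evalY_apply (z : ℂ) (u : Fin n × Fin 2 → ℂ) (j : Fin n) :
    G.evalY z u j = G.embed j (G.solOp j z (ContinuousMap.const _ fun k => u (j, k))) :=
  G.Y_mulVec_eq_solOp_toLp j z _

theorem evalY_ae (z : ℂ) (u : Fin n × Fin 2 → ℂ) (j : Fin n) :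
    ∀ᵐ x ∂(G.μ j), WithLp.ofLp (G.evalY z u j x) = G.Y j z x *ᵥ fun k => u (j, k) := by
  filter_upwards [(G.memLp_Y_mulVec j z fun k => u (j, k)).coeFn_toLp] with x hx
  exact congrArg WithLp.ofLp hx

/-- A continuous representative is determined by its class, and `Y = I` at the central vertex
recovers `u`. -/
theorem evalY_injective (z : ℂ) : Function.Injective (G.evalY z) := by
  rw [injective_iff_map_eq_zero]
  intro u hu
  ext ⟨j, k⟩
  have hc := (G.Y_mulVec_absCont j z fun k => u (j, k)).continuousOn
  rw [Set.uIcc_of_le (G.v_le_w j)] at hc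
  have hz : ∀ᵐ x ∂(G.μ j), G.Y j z x *ᵥ (fun k => u (j, k)) = (0 : ℝ → Fin 2 → ℂ) x := by
    filter_upwards [G.evalY_ae z u j, Lp.coeFn_zero (EuclideanSpace ℂ (Fin 2)) 2 (G.μ j)] with x h1 h2
    rw [← h1, hu]
    exact congrArg WithLp.ofLp h2
  have h := Measure.eqOn_Icc_of_ae_eq volume (G.v_lt_w j).ne hz hc continuousOn_const
    (Set.left_mem_Icc.2 (G.v_le_w j))
  simp only [Y_left, Matrix.one_mulVec] at h
  exact congrFun h k

theorem IsEdgeFunction.diracExpr_eq {j : Fin n} {F : ℝ → Fin 2 → ℂ} {f g : G.EdgeL2 j} {z : ℂ}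
    (h : G.IsEdgeFunction j F f (z • f + g)) :
    ∀ᵐ x ∂(G.μ j), G.diracExpr j F x = z • F x + WithLp.ofLp (g x) := by
  filter_upwards [h.expr, h.rep, Lp.coeFn_add (z • f) g, Lp.coeFn_smul z f] with x h1 h2 h3 h4
  rw [← h1, h3, Pi.add_apply, h4, Pi.smul_apply, WithLp.ofLp_add, WithLp.ofLp_smul, h2]

theorem IsEdgeFunction.eq_embed {j : Fin n} {F : ℝ → Fin 2 → ℂ} {f g : G.EdgeL2 j} {z : ℂ}
    (h : G.IsEdgeFunction j F f (z • f + g)) :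
    f = G.embed j (G.solOp j z (ContinuousMap.const _ (F G.v) + G.drive j g)) :=
  G.eq_embed h.rep (G.eq_solOp h.absCont (G.intervalIntegrable_ofLp g) h.diracExpr_eq)

theorem isEdgeFunction_solution (j : Fin n) (z : ℂ) (u : Fin 2 → ℂ) (g : G.L2)
    (h : G.b j z * (u 0 - G.edgeIntegral g z (j, 1)) +
      G.c j z * (u 1 + G.edgeIntegral g z (j, 0)) = 0) :
    G.IsEdgeFunction j (G.solution j z u _ (G.intervalIntegrable_ofLp (g j)))
      (G.embed j (G.solOp j z (ContinuousMap.const _ u + G.drive j (g j))))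
      (z • G.embed j (G.solOp j z (ContinuousMap.const _ u + G.drive j (g j))) + g j) := by
  have hg := G.intervalIntegrable_ofLp (g j)
  refine ⟨G.solution_absCont j z u _ hg, G.embed_ae j _, ?_, ?_⟩
  · rw [G.outer_eq (G.solution_absCont j z u _ hg) (G.solution_eqn j z u _ hg), solution_left]
    exact h
  · set f := G.embed j (G.solOp j z (ContinuousMap.const _ u + G.drive j (g j)))
    have hf : ∀ᵐ x ∂(G.μ j), WithLp.ofLp (f x) = G.solution j z u _ hg x := G.embed_ae j _
    filter_upwards [G.solution_eqn j z u _ hg, hf, Lp.coeFn_add (z • f) (g j),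
      Lp.coeFn_smul z f] with x h1 h2 h3 h4
    rw [h1, h3, Pi.add_apply, h4, Pi.smul_apply, WithLp.ofLp_add, WithLp.ofLp_smul, h2]

/-! ### The star graph -/

/-- The embedding of `L²(e_j)` into `L²(𝒢)`. -/
def inclL2 (j : Fin n) : G.EdgeL2 j →L[ℂ] G.L2 :=
  (PiLp.continuousLinearEquiv 2 ℂ fun j => G.EdgeL2 j).symm.toContinuousLinearMap ∘L
    ContinuousLinearMap.single ℂ (fun j => G.EdgeL2 j) j

/-- The operator mapping `g` to the solution of `H f = z f + g`, `f(v) = 0`. -/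
def freeRes (z : ℂ) : G.L2 →L[ℂ] G.L2 :=
  ∑ j, (G.inclL2 j ∘L G.embed j) ∘L G.solOp j z ∘L
    (G.drive j ∘L PiLp.proj 2 (fun j => G.EdgeL2 j) j)

theorem inclL2_apply (i j : Fin n) (f : G.EdgeL2 i) :
    G.inclL2 i f j = (Pi.single i f : ∀ j, G.EdgeL2 j) j := rfl

theorem freeRes_apply (z : ℂ) (g : G.L2) (j : Fin n) :
    G.freeRes z g j = G.embed j (G.solOp j z (G.drive j (g j))) := by
  have h : ∀ i, (((G.inclL2 i ∘L G.embed i) ∘L G.solOp i z ∘L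
    (G.drive i ∘L PiLp.proj 2 (fun j => G.EdgeL2 j) i)) g : G.L2) j =
      (Pi.single i (G.embed i (G.solOp i z (G.drive i (g i)))) : ∀ j, G.EdgeL2 j) j := fun i => rfl
  rw [freeRes, sum_apply, WithLp.ofLp_sum, Finset.sum_apply,
    Finset.sum_congr rfl fun i _ => h i]
  exact Finset.sum_pi_single j (fun i => G.embed i (G.solOp i z (G.drive i (g i)))) _ |>.trans
    (if_pos (Finset.mem_univ j))

theorem differentiable_freeRes : Differentiable ℂ G.freeRes := by
  unfold freeRes
  exact Differentiable.fun_sum fun j _ => differentiable_comp_comp (G.differentiable_solOp j) _ _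

theorem evalY_single (z : ℂ) (j : Fin n) (k : Fin 2) : G.evalY z (Pi.single (j, k) 1) =
    G.inclL2 j (G.embed j (G.solOp j z (ContinuousMap.const _ (Pi.single k 1)))) := by
  ext1 i
  rw [evalY_apply, inclL2_apply]
  by_cases hij : i = j
  · subst hij
    rw [Pi.single_eq_same]
    congr 3
    ext l
    simp [Pi.single_apply]
  · rw [Pi.single_eq_of_ne hij]
    have : (ContinuousMap.const (Set.Icc G.v (G.w i))
        fun l => (Pi.single (j, k) 1 : Fin n × Fin 2 → ℂ) (i, l)) = 0 := by
      ext x l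
      simp [hij]
    rw [this, map_zero, map_zero]

/-- The map `t ↦ t 𝐘(·, z) e_a` for the basis vector `e_a` of `ℂ²ⁿ`. -/
def evalYSpan (z : ℂ) (a : Fin n × Fin 2) : ℂ →L[ℂ] G.L2 :=
  (G.inclL2 a.1 ∘L G.embed a.1) ∘L G.solOp a.1 z ∘L
    ContinuousLinearMap.toSpanSingleton ℂ (ContinuousMap.const _ (Pi.single a.2 1))

theorem evalYSpan_apply (z : ℂ) (a : Fin n × Fin 2) (t : ℂ) :
    G.evalYSpan z a t = t • G.evalY z (Pi.single a 1) := by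
  obtain ⟨j, k⟩ := a
  rw [evalY_single, ← map_smul, ← map_smul, ← map_smul]
  rfl

theorem differentiable_evalYSpan (a : Fin n × Fin 2) :
    Differentiable ℂ fun z => G.evalYSpan z a :=
  differentiable_comp_comp (G.differentiable_solOp a.1) _ _

theorem differentiable_Y_apply (j : Fin n) (i k : Fin 2) :
    Differentiable ℂ fun z => G.Y j z (G.w j) i k := by
  have hw : G.w j ∈ Set.Icc G.v (G.w j) := Set.right_mem_Icc.2 (G.v_le_w j)
  have h : ∀ z, G.Y j z (G.w j) i k = (ContinuousLinearMap.proj (R := ℂ) (φ := fun _ : Fin 2 => ℂ) i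
      ∘L ContinuousMap.evalCLM ℂ (⟨G.w j, hw⟩ : Set.Icc G.v (G.w j)))
        (G.solOp j z (ContinuousMap.const _ (Pi.single k 1))) := by
    intro z
    have := congrFun (G.Y_mulVec_eq_solOp j z (Pi.single k 1) ⟨G.w j, hw⟩) i
    rw [Matrix.mulVec_single_one] at this
    exact this
  simp_rw [h]
  exact differentiable_comp_apply (G.differentiable_solOp j) _ _

theorem differentiable_b (j : Fin n) : Differentiable ℂ (G.b j) :=
  ((G.differentiable_Y_apply j 0 0).mul_const _).add ((G.differentiable_Y_apply j 1 0).mul_const _)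

theorem differentiable_c (j : Fin n) : Differentiable ℂ (G.c j) :=
  ((G.differentiable_Y_apply j 0 1).mul_const _).add ((G.differentiable_Y_apply j 1 1).mul_const _)

/-- The functional `g ↦ I(g, z)_a`. -/
def edgeFunctional (z : ℂ) (a : Fin n × Fin 2) : G.L2 →L[ℂ] ℂ :=
  G.Y a.1 z (G.w a.1) 0 a.2 • ((ContinuousLinearMap.proj (R := ℂ) (φ := fun _ : Fin 2 => ℂ) 1 ∘L
      ContinuousMap.evalCLM ℂ
        (⟨G.w a.1, Set.right_mem_Icc.2 (G.v_le_w a.1)⟩ : Set.Icc G.v (G.w a.1))) ∘L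
      G.solOp a.1 z ∘L (G.drive a.1 ∘L PiLp.proj 2 (fun j => G.EdgeL2 j) a.1)) -
  G.Y a.1 z (G.w a.1) 1 a.2 • ((ContinuousLinearMap.proj (R := ℂ) (φ := fun _ : Fin 2 => ℂ) 0 ∘L
      ContinuousMap.evalCLM ℂ
        (⟨G.w a.1, Set.right_mem_Icc.2 (G.v_le_w a.1)⟩ : Set.Icc G.v (G.w a.1))) ∘L
      G.solOp a.1 z ∘L (G.drive a.1 ∘L PiLp.proj 2 (fun j => G.EdgeL2 j) a.1))

/-- In `edgeIntegral_eq` the solution with zero initial value leaves only its value at the outer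
vertex. In this form boundedness in `g` and holomorphy in `z` are inherited from `solOp`. -/
theorem edgeFunctional_apply (z : ℂ) (a : Fin n × Fin 2) (g : G.L2) :
    G.edgeFunctional z a g = G.edgeIntegral g z a := by
  obtain ⟨j, k⟩ := a
  have hw : G.w j ∈ Set.Icc G.v (G.w j) := Set.right_mem_Icc.2 (G.v_le_w j)
  have hg := G.intervalIntegrable_ofLp (g j)
  have hs : G.solution j z 0 _ hg (G.w j) = G.solOp j z (G.drive j (g j)) ⟨G.w j, hw⟩ := by
    rw [solution, Set.IccExtend_of_mem _ _ hw, source_eq]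
    congr 2
    exact zero_add _
  rw [G.edgeIntegral_eq (G.solution_absCont j z 0 _ hg) (G.solution_eqn j z 0 _ hg), solution_left,
    hs]
  change G.Y j z (G.w j) 0 k * _ - G.Y j z (G.w j) 1 k * _ = _
  simp [wedge]

theorem differentiable_edgeFunctional (a : Fin n × Fin 2) :
    Differentiable ℂ fun z => G.edgeFunctional z a :=
  ((G.differentiable_Y_apply a.1 0 a.2).smul
      (differentiable_comp_comp (G.differentiable_solOp a.1) _ _)).sub
    ((G.differentiable_Y_apply a.1 1 a.2).smul
      (differentiable_comp_comp (G.differentiable_solOp a.1) _ _))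

/-- The boundary values `(f₁♯(v), f₂♯(v))` of a vector in `ℂ²ⁿ`, ordered by edges. -/
def split (u : Fin n × Fin 2 → ℂ) : (Fin n → ℂ) × (Fin n → ℂ) :=
  (fun j => u (j, 0), fun j => u (j, 1))

/-- The outer boundary condition on the data `u = f(v)` and `I` of a solution of
`H f = z f + g`. -/
def OuterCondition (z : ℂ) (u I : Fin n × Fin 2 → ℂ) : Prop :=
  ∀ j, G.b j z * (u (j, 0) - I (j, 1)) + G.c j z * (u (j, 1) + I (j, 0)) = 0

theorem exists_edgeFunction {z : ℂ} {u : Fin n × Fin 2 → ℂ} {g : G.L2}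
    (h : G.OuterCondition z u (G.edgeIntegral g z)) :
    ∃ F : Fin n → ℝ → Fin 2 → ℂ, (∀ j, G.IsEdgeFunction j (F j)
      ((G.evalY z u + G.freeRes z g) j) ((z • (G.evalY z u + G.freeRes z g) + g) j)) ∧
      ∀ j k, F j G.v k = u (j, k) := by
  refine ⟨fun j => G.solution j z (fun k => u (j, k)) _ (G.intervalIntegrable_ofLp (g j)),
    fun j => ?_, fun j k => congrFun (G.solution_left j z _ _ _) k⟩
  have := G.isEdgeFunction_solution j z (fun k => u (j, k)) g (h j)
  have e : (G.evalY z u + G.freeRes z g) j = G.embed j (G.solOp j z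
      ((ContinuousMap.const _ fun k => u (j, k)) + G.drive j (g j))) := by
    rw [map_add, map_add, PiLp.add_apply, evalY_apply, freeRes_apply]
  have e' : (z • (G.evalY z u + G.freeRes z g) + g) j =
      z • (G.evalY z u + G.freeRes z g) j + g j := rfl
  rw [e', e]
  exact this

theorem eq_of_edgeFunction {z : ℂ} {f g : G.L2} {F : Fin n → ℝ → Fin 2 → ℂ}
    (h : ∀ j, G.IsEdgeFunction j (F j) (f j) ((z • f + g) j)) :
    G.OuterCondition z (fun a => F a.1 G.v a.2) (G.edgeIntegral g z) ∧
      f = G.evalY z (fun a => F a.1 G.v a.2) + G.freeRes z g := by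
  refine ⟨fun j => ?_, ?_⟩
  · have hj := h j
    rw [PiLp.add_apply, PiLp.smul_apply] at hj
    rw [← G.outer_eq hj.absCont hj.diracExpr_eq]
    exact hj.outer
  · ext1 j
    have hj := h j
    rw [PiLp.add_apply, PiLp.smul_apply] at hj
    rw [hj.eq_embed, PiLp.add_apply, evalY_apply, freeRes_apply, map_add, map_add]

/-- The reduction to finite dimensions: all later questions about `(T - z) f = g` become linear
equations for the initial data `u`. -/
theorem mem_vertexGraph_iff {L : Submodule ℂ ((Fin n → ℂ) × (Fin n → ℂ))} {z : ℂ} {f g : G.L2} :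
    (f, z • f + g) ∈ G.vertexGraph L ↔ ∃ u : Fin n × Fin 2 → ℂ,
      G.OuterCondition z u (G.edgeIntegral g z) ∧ split u ∈ L ∧
        f = G.evalY z u + G.freeRes z g := by
  constructor
  · rintro ⟨F, hF, hL⟩
    exact ⟨_, (G.eq_of_edgeFunction hF).1, hL, (G.eq_of_edgeFunction hF).2⟩
  · rintro ⟨u, hu, hL, rfl⟩
    obtain ⟨F, hF, hv⟩ := G.exists_edgeFunction hu
    refine ⟨F, hF, ?_⟩
    simp_rw [hv]
    exact hL

/-! ### Green's identity on the star graph -/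

/-- Both end values are multiples of the same real vector `(sin α, -cos α)`, on whose span the form
vanishes. -/
theorem IsEdgeFunction.wedge_outer {j : Fin n} {F H : ℝ → Fin 2 → ℂ} {f g f' g' : G.EdgeL2 j}
    (h : G.IsEdgeFunction j F f g) (h' : G.IsEdgeFunction j H f' g') :
    wedge (H (G.w j)) (F (G.w j)) = 0 := by
  have h1 := h.outer
  have h2 := congrArg conj h'.outer
  simp only [map_add, map_mul, Complex.conj_ofReal, map_zero] at h2
  have h3 : (Real.sin (G.α j) : ℂ) ^ 2 + (Real.cos (G.α j) : ℂ) ^ 2 = 1 := by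
    exact_mod_cast Real.sin_sq_add_cos_sq (G.α j)
  rw [wedge]
  linear_combination (-(conj (H (G.w j) 1) * F (G.w j) 0 - conj (H (G.w j) 0) * F (G.w j) 1)) * h3 +
    ((Real.cos (G.α j) : ℂ) * conj (H (G.w j) 1) - (Real.sin (G.α j) : ℂ) * conj (H (G.w j) 0)) * h1 +
    ((Real.sin (G.α j) : ℂ) * F (G.w j) 0 - (Real.cos (G.α j) : ℂ) * F (G.w j) 1) * h2

theorem IsEdgeFunction.green {j : Fin n} {F H : ℝ → Fin 2 → ℂ} {f g f' g' : G.EdgeL2 j}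
    (h : G.IsEdgeFunction j F f g) (h' : G.IsEdgeFunction j H f' g') :
    inner ℂ f' g - inner ℂ g' f = wedge (H G.v) (F G.v) := by
  have key := G.green h.absCont h'.absCont (G.integrable_ofLp g) (G.integrable_ofLp g')
    (h.expr.mono fun _ hx => hx.symm) (h'.expr.mono fun _ hx => hx.symm)
  rw [h.wedge_outer G h', sub_zero] at key
  rw [← key, L2.inner_def, L2.inner_def, ← integral_sub (L2.integrable_inner _ _)
    (L2.integrable_inner _ _)]
  refine integral_congr_ae ?_
  filter_upwards [h.rep, h'.rep] with x h1 h2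
  rw [PiLp.inner_apply, PiLp.inner_apply, ← h1, ← h2]
  simp
  ring

theorem green_star {F H : Fin n → ℝ → Fin 2 → ℂ} {f g f' g' : G.L2}
    (h : ∀ j, G.IsEdgeFunction j (F j) (f j) (g j))
    (h' : ∀ j, G.IsEdgeFunction j (H j) (f' j) (g' j)) :
    inner ℂ f' g - inner ℂ g' f = ∑ j, wedge (H j G.v) (F j G.v) := by
  rw [PiLp.inner_apply, PiLp.inner_apply, ← Finset.sum_sub_distrib]
  exact Finset.sum_congr rfl fun j _ => (h j).green G (h' j)

/-- In other words, `I(·, z)` is the adjoint of `evalY (conj z)`; the adjoints of `kernelMap` and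
`Γ` are computed from this. -/
theorem inner_evalY (z : ℂ) (u : Fin n × Fin 2 → ℂ) (g : G.L2) :
    inner ℂ (G.evalY (conj z) u) g = ∑ a, conj (u a) * G.edgeIntegral g z a := by
  rw [PiLp.inner_apply, Fintype.sum_prod_type]
  refine Finset.sum_congr rfl fun j _ => ?_
  have hint : ∀ k, Integrable (fun ξ => ((G.Y j (conj z) ξ)ᴴ *ᵥ WithLp.ofLp (g j ξ)) k) (G.μ j) := by
    intro k
    simp only [Matrix.mulVec, dotProduct, Matrix.conjTranspose_apply]
    refine integrable_finsetSum _ fun i _ => ?_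
    rw [← G.intervalIntegrable_iff_integrable]
    have hc := ((G.isFundamentalMatrix_Y j (conj z)).absCont k).continuousOn
    refine (G.intervalIntegrable_iff_integrable.2
      ((G.integrable_ofLp (g j)).eval i)).continuousOn_mul ?_
    exact Complex.continuous_conj.comp_continuousOn (continuousOn_pi.1 hc i)
  simp only [edgeIntegral]
  rw [L2.inner_def, Finset.sum_congr rfl fun k _ => (integral_const_mul _ _).symm]
  refine Eq.trans ?_ (integral_finsetSum (μ := G.μ j) _ fun k _ => (hint k).const_mul _)
  refine integral_congr_ae ?_
  filter_upwards [G.evalY_ae (conj z) u j] with x hx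
  rw [PiLp.inner_apply, hx]
  simp [Matrix.mulVec, dotProduct]
  ring

end StarGraph

/-! ### The symplectic form on the space of boundary values -/

section Symplectic

variable {n : ℕ}

/-- The form `Σ_j (p̂_j* q_j - p_j* q̂_j)` on `ℂⁿ × ℂⁿ`. -/
def symp (p q : (Fin n → ℂ) × (Fin n → ℂ)) : ℂ :=
  ∑ j, (conj (p.2 j) * q.1 j - conj (p.1 j) * q.2 j)

theorem symp_conj (p q : (Fin n → ℂ) × (Fin n → ℂ)) : conj (symp p q) = -symp q p := by
  rw [symp, symp, map_sum, ← Finset.sum_neg_distrib]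
  refine Finset.sum_congr rfl fun j _ => ?_
  simp
  ring

theorem symp_eq_zero_comm {p q : (Fin n → ℂ) × (Fin n → ℂ)} : symp p q = 0 ↔ symp q p = 0 := by
  rw [← neg_eq_zero (a := symp q p), ← symp_conj, map_eq_zero]

/-- The orthogonal complement with respect to the form `symp`. -/
def sympOrth (L : Submodule ℂ ((Fin n → ℂ) × (Fin n → ℂ))) :
    Submodule ℂ ((Fin n → ℂ) × (Fin n → ℂ)) where
  carrier := {p | ∀ q ∈ L, symp p q = 0}
  add_mem' := by
    intro a b ha hb q hq
    have h : symp (a + b) q = symp a q + symp b q := by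
      simp only [symp, ← Finset.sum_add_distrib]
      refine Finset.sum_congr rfl fun j _ => ?_
      simp
      ring
    rw [h, ha q hq, hb q hq, add_zero]
  zero_mem' := by
    intro q _
    simp [symp]
  smul_mem' := by
    intro c a ha q hq
    have h : symp (c • a) q = conj c * symp a q := by
      simp only [symp, Finset.mul_sum]
      refine Finset.sum_congr rfl fun j _ => ?_
      simp
      ring
    rw [h, ha q hq, mul_zero]

theorem sympOrth_bot : sympOrth (⊥ : Submodule ℂ ((Fin n → ℂ) × (Fin n → ℂ))) = ⊤ := by
  rw [eq_top_iff]
  intro p _ q hq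
  rw [Submodule.mem_bot] at hq
  simp [symp, hq]

end Symplectic

/-! ### Boundary values at the central vertex -/

namespace StarGraph

variable {n : ℕ} (G : StarGraph n)

/-- The boundary values at the central vertex. -/
def bv (F : Fin n → ℝ → Fin 2 → ℂ) : (Fin n → ℂ) × (Fin n → ℂ) :=
  (fun j => F j G.v 0, fun j => F j G.v 1)

theorem green_symp {F H : Fin n → ℝ → Fin 2 → ℂ} {f g f' g' : G.L2}
    (h : ∀ j, G.IsEdgeFunction j (F j) (f j) (g j))
    (h' : ∀ j, G.IsEdgeFunction j (H j) (f' j) (g' j)) :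
    inner ℂ f' g - inner ℂ g' f = symp (G.bv H) (G.bv F) := G.green_star h h'

theorem vertexGraph_mono {L L' : Submodule ℂ ((Fin n → ℂ) × (Fin n → ℂ))} (h : L ≤ L') :
    G.vertexGraph L ≤ G.vertexGraph L' := fun _ ⟨F, hF, hL⟩ => ⟨F, hF, h hL⟩

theorem edgeFunction_sub {F H : Fin n → ℝ → Fin 2 → ℂ} {f g f' g' : G.L2}
    (h : ∀ j, G.IsEdgeFunction j (F j) (f j) (g j))
    (h' : ∀ j, G.IsEdgeFunction j (H j) (f' j) (g' j)) (j : Fin n) :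
    G.IsEdgeFunction j ((F - H) j) ((f - f') j) ((g - g') j) := by
  have e := (h j).add G ((h' j).smul G (-1))
  rw [neg_one_smul, neg_one_smul, neg_one_smul, ← sub_eq_add_neg, ← sub_eq_add_neg,
    ← sub_eq_add_neg] at e
  exact e

theorem bv_sub (F H : Fin n → ℝ → Fin 2 → ℂ) : G.bv (F - H) = G.bv F - G.bv H := rfl

/-- The boundary values of an edge function are determined by its class. -/
theorem bv_eq {F H : Fin n → ℝ → Fin 2 → ℂ} {f g g' : G.L2}
    (h : ∀ j, G.IsEdgeFunction j (F j) (f j) (g j))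
    (h' : ∀ j, G.IsEdgeFunction j (H j) (f j) (g' j)) : G.bv F = G.bv H := by
  have e : ∀ j, F j G.v = H j G.v := by
    intro j
    have hz := ((G.edgeFunction_sub h h' j).eq_zero G (by rw [sub_self]; rfl)).1 G.v
      (Set.left_mem_Icc.2 (G.v_le_w j))
    exact sub_eq_zero.1 hz
  simp only [bv, e]

/-! ### The range of the minimal operator -/

theorem edgeIntegral_zero (z : ℂ) : G.edgeIntegral 0 z = 0 := by
  ext a
  rw [← edgeFunctional_apply, map_zero]
  rfl

/-- The solutions of `H f = 0` satisfying the outer boundary conditions. -/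
def kernelMap : EuclideanSpace ℂ (Fin n) →L[ℂ] G.L2 :=
  LinearMap.toContinuousLinearMap (G.evalY 0 ∘ₗ
    { toFun := fun t jk => t jk.1 * ![G.c jk.1 0, -G.b jk.1 0] jk.2
      map_add' := fun s t => by ext; simp [add_mul]
      map_smul' := fun s t => by ext; simp [mul_assoc] })

theorem kernelMap_apply (t : EuclideanSpace ℂ (Fin n)) :
    G.kernelMap t = G.evalY 0 fun jk => t jk.1 * ![G.c jk.1 0, -G.b jk.1 0] jk.2 := rfl

/-- The numbers `b j 0` and `c j 0` are real. The right-hand side vanishes for all `j` exactly when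
`freeRes 0 g` meets the outer conditions, so the kernel of the adjoint is the range of `S`. -/
theorem adjoint_kernelMap_apply (g : G.L2) (j : Fin n) : ContinuousLinearMap.adjoint G.kernelMap g j =
    G.c j 0 * G.edgeIntegral g 0 (j, 0) - G.b j 0 * G.edgeIntegral g 0 (j, 1) := by
  have h := ContinuousLinearMap.adjoint_inner_right G.kernelMap (EuclideanSpace.single j 1) g
  have hb := G.b_conj j 0
  have hc := G.c_conj j 0
  rw [map_zero] at hb hc
  have h2 := G.inner_evalY 0 (fun jk => (EuclideanSpace.single j 1 : EuclideanSpace ℂ (Fin n)) jk.1 *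
    ![G.c jk.1 0, -G.b jk.1 0] jk.2) g
  rw [map_zero] at h2
  rw [kernelMap_apply, h2, Fintype.sum_prod_type] at h
  simp [EuclideanSpace.inner_single_left] at h
  rw [h]
  rw [Finset.sum_eq_single j]
  · simp [← hb, ← hc]
    ring
  · intro i _ hi
    simp [hi]
  · simp

theorem kernelMap_injective : Function.Injective G.kernelMap := by
  rw [injective_iff_map_eq_zero]
  intro t ht
  rw [kernelMap_apply, ← map_zero (G.evalY 0)] at ht
  have h := G.evalY_injective 0 ht
  ext j
  have h0 := congrFun h (j, 0)
  have h1 := congrFun h (j, 1)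
  simp at h0 h1
  rcases G.b_c_ne_zero j 0 with hb | hc
  · simpa [hb] using h1
  · simpa [hc] using h0

theorem adjoint_kernelMap_surjective :
    Function.Surjective (ContinuousLinearMap.adjoint G.kernelMap) := by
  have h := ContinuousLinearMap.orthogonal_range (ContinuousLinearMap.adjoint G.kernelMap)
  rw [ContinuousLinearMap.adjoint_adjoint, LinearMap.ker_eq_bot.2 G.kernelMap_injective,
    Submodule.orthogonal_eq_bot_iff] at h
  exact LinearMap.range_eq_top.1 h

theorem orthogonal_ker_adjoint_kernelMap :
    (LinearMap.ker (ContinuousLinearMap.adjoint G.kernelMap).toLinearMap)ᗮ =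
      LinearMap.range G.kernelMap.toLinearMap := by
  have h := ContinuousLinearMap.orthogonal_range G.kernelMap
  rw [← h, Submodule.orthogonal_orthogonal]

theorem kernelMap_mem (t : EuclideanSpace ℂ (Fin n)) :
    (G.kernelMap t, (0 : G.L2)) ∈ G.vertexGraph ⊤ := by
  have h := (G.mem_vertexGraph_iff (L := ⊤) (z := 0) (f := G.kernelMap t) (g := 0)).2
    ⟨_, ?_, Submodule.mem_top, by
      rw [kernelMap_apply, map_zero (G.freeRes 0), add_zero]⟩
  · simpa using h
  · intro j
    simp [edgeIntegral_zero]
    ring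

/-- Every boundary value is attained. -/
theorem exists_bv_eq (p : (Fin n → ℂ) × (Fin n → ℂ)) : ∃ (f g : G.L2) (F : Fin n → ℝ → Fin 2 → ℂ),
    (∀ j, G.IsEdgeFunction j (F j) (f j) (g j)) ∧ G.bv F = p := by
  obtain ⟨g, hg⟩ := G.adjoint_kernelMap_surjective
    (WithLp.toLp 2 fun j => -(G.b j 0 * p.1 j + G.c j 0 * p.2 j))
  obtain ⟨F, hF, hv⟩ := G.exists_edgeFunction (z := 0) (g := g)
    (u := fun jk => ![p.1 jk.1, p.2 jk.1] jk.2) (by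
      intro j
      have h := G.adjoint_kernelMap_apply g j
      rw [hg] at h
      simp at h ⊢
      linear_combination -h)
  refine ⟨_, _, F, hF, ?_⟩
  ext j <;> simp [bv, hv]

/-- This is the nontrivial inclusion for `S*`. If `φ` in the maximal domain solves `H φ = k`, then
`h - φ` is orthogonal to the range of `S`, hence is a solution of `H f = 0` in the range of
`kernelMap`. -/
theorem mem_vertexGraph_top_of_orthogonal {h k : G.L2}
    (H : ∀ f g, (f, g) ∈ G.vertexGraph ⊥ → inner ℂ g h - inner ℂ f k = 0) :
    (h, k) ∈ G.vertexGraph ⊤ := by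
  -- These initial data annihilate both brackets in the outer condition.
  have hφ := (G.mem_vertexGraph_iff (L := ⊤) (z := 0) (g := k)
    (f := G.evalY 0 (fun jk => ![G.edgeIntegral k 0 (jk.1, 1), -G.edgeIntegral k 0 (jk.1, 0)] jk.2) +
      G.freeRes 0 k)).2 ⟨_, fun j => by simp, Submodule.mem_top, rfl⟩
  rw [zero_smul, zero_add] at hφ
  set φ := G.evalY 0 (fun jk => ![G.edgeIntegral k 0 (jk.1, 1), -G.edgeIntegral k 0 (jk.1, 0)] jk.2) +
      G.freeRes 0 k
  have horth : h - φ ∈ (LinearMap.ker (ContinuousLinearMap.adjoint G.kernelMap).toLinearMap)ᗮ := by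
    rw [Submodule.mem_orthogonal]
    intro g hg
    have hg' : ∀ j, G.c j 0 * G.edgeIntegral g 0 (j, 0) - G.b j 0 * G.edgeIntegral g 0 (j, 1) = 0 := by
      intro j
      rw [← adjoint_kernelMap_apply]
      have : ContinuousLinearMap.adjoint G.kernelMap g = 0 := hg
      rw [this]; rfl
    have hf := (G.mem_vertexGraph_iff (L := ⊥) (z := 0) (g := g) (f := G.freeRes 0 g)).2
      ⟨0, fun j => by simpa [neg_add_eq_sub] using hg' j, Submodule.zero_mem _, by
        rw [map_zero, zero_add]⟩
    rw [zero_smul, zero_add] at hf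
    have h1 := H _ _ hf
    obtain ⟨F, hF, hL⟩ := hf
    obtain ⟨F', hF', -⟩ := hφ
    have h2 := G.green_symp hF' hF
    have hz : G.bv F = 0 := (Submodule.mem_bot ℂ).1 hL
    have hs : symp (G.bv F) (G.bv F') = 0 := by rw [hz]; simp [symp]
    rw [hs] at h2
    rw [inner_sub_right]
    linear_combination h1 + h2
  rw [orthogonal_ker_adjoint_kernelMap] at horth
  obtain ⟨t, ht⟩ := horth
  have := (G.vertexGraph ⊤).add_mem (G.kernelMap_mem t) hφ
  have e : G.kernelMap t = h - φ := ht
  rw [e, Prod.mk_add_mk, sub_add_cancel, zero_add] at this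
  exact this

/-! ### Adjoints -/

/-- If `h` is orthogonal to the domain, then `(0, h)` lies in the graph of the maximal operator,
which is single-valued. -/
theorem dense_vertexOp_domain (L : Submodule ℂ ((Fin n → ℂ) × (Fin n → ℂ))) :
    Dense ((G.vertexOp L).domain : Set G.L2) := by
  rw [Submodule.dense_iff_topologicalClosure_eq_top, Submodule.topologicalClosure_eq_top_iff,
    Submodule.eq_bot_iff]
  intro h hh
  rw [Submodule.mem_orthogonal] at hh
  have hm := G.mem_vertexGraph_top_of_orthogonal (h := 0) (k := h) fun f g hfg => by
    have hf : f ∈ (G.vertexOp L).domain := by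
      rw [LinearPMap.mem_domain_iff]
      exact ⟨g, by rw [vertexOp_graph]; exact G.vertexGraph_mono bot_le hfg⟩
    rw [hh f hf, inner_zero_right, sub_zero]
  exact G.vertexGraph_snd_eq_zero _ _ hm rfl

/-- The adjoint is contained in the maximal operator, where Green's identity turns the adjoint
relation into symplectic orthogonality. Every element of `L` occurs as a boundary value, so nothing
is lost. -/
theorem vertexOp_adjoint (L : Submodule ℂ ((Fin n → ℂ) × (Fin n → ℂ))) :
    (G.vertexOp L).adjoint = G.vertexOp (sympOrth L) := by
  refine LinearPMap.eq_of_eq_graph ?_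
  rw [LinearPMap.adjoint_graph_eq_graph_adjoint (G.dense_vertexOp_domain L), vertexOp_graph,
    vertexOp_graph]
  ext ⟨h, k⟩
  rw [Submodule.mem_adjoint_iff]
  constructor
  · intro H
    obtain ⟨F, hF, -⟩ := G.mem_vertexGraph_top_of_orthogonal fun f g hfg =>
      H f g (G.vertexGraph_mono bot_le hfg)
    refine ⟨F, hF, fun q hq => ?_⟩
    obtain ⟨f, g, F', hF', rfl⟩ := G.exists_bv_eq q
    have h1 := H f g ⟨F', hF', hq⟩
    have h2 := G.green_symp hF hF'
    rw [symp_eq_zero_comm]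
    change symp (G.bv F') (G.bv F) = 0
    rw [← h2]
    linear_combination -h1
  · rintro ⟨F, hF, hL⟩ f g ⟨F', hF', hL'⟩
    have h2 := G.green_symp hF hF'
    have h3 : symp (G.bv F') (G.bv F) = 0 := symp_eq_zero_comm.1 (hL _ hL')
    rw [h3] at h2
    linear_combination -h2

theorem vertexGraph_injective : Function.Injective G.vertexGraph := by
  have key : ∀ L L', G.vertexGraph L = G.vertexGraph L' → L ≤ L' := by
    intro L L' h p hp
    obtain ⟨f, g, F, hF, rfl⟩ := G.exists_bv_eq p
    have hm : (f, g) ∈ G.vertexGraph L := ⟨F, hF, hp⟩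
    rw [h] at hm
    obtain ⟨F', hF', hL'⟩ := hm
    rw [G.bv_eq hF hF']
    exact hL'
  exact fun L L' h => le_antisymm (key _ _ h) (key _ _ h.symm)

theorem vertexOp_injective : Function.Injective G.vertexOp := fun L L' h =>
  G.vertexGraph_injective (by rw [← vertexOp_graph, h, vertexOp_graph])

theorem S_adjoint : G.S.adjoint = G.Smax := by
  rw [S, vertexOp_adjoint, sympOrth_bot, Smax]

theorem S_le_vertexOp (L : Submodule ℂ ((Fin n → ℂ) × (Fin n → ℂ))) : G.S ≤ G.vertexOp L := by
  rw [← LinearPMap.le_graph_iff, S, vertexOp_graph, vertexOp_graph]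
  exact G.vertexGraph_mono bot_le

/-- A self-adjoint extension of the minimal operator is given by its boundary values. -/
theorem exists_eq_vertexOp {T : G.L2 →ₗ.[ℂ] G.L2} (hS : G.S ≤ T) (hT : IsSelfAdjoint T) :
    ∃ L, sympOrth L = L ∧ T = G.vertexOp L := by
  have hSg : G.vertexGraph ⊥ ≤ T.graph := by
    rw [← G.vertexOp_graph]; exact LinearPMap.le_graph_of_le hS
  have hgraph : T.graph = T.graph.adjoint := by
    rw [← LinearPMap.adjoint_graph_eq_graph_adjoint hT.dense_domain,
      LinearPMap.isSelfAdjoint_def.1 hT]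
  have hmax : ∀ h k, (h, k) ∈ T.graph → (h, k) ∈ G.vertexGraph ⊤ := by
    intro h k hk
    rw [hgraph, Submodule.mem_adjoint_iff] at hk
    exact G.mem_vertexGraph_top_of_orthogonal fun f g hfg => hk f g (hSg hfg)
  let L : Submodule ℂ ((Fin n → ℂ) × (Fin n → ℂ)) :=
    { carrier := {p | ∃ (f g : G.L2) (F : Fin n → ℝ → Fin 2 → ℂ), (f, g) ∈ T.graph ∧
        (∀ j, G.IsEdgeFunction j (F j) (f j) (g j)) ∧ G.bv F = p}
      add_mem' := by
        rintro _ _ ⟨f, g, F, hm, hF, rfl⟩ ⟨f', g', F', hm', hF', rfl⟩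
        exact ⟨_, _, F + F', T.graph.add_mem hm hm', fun j => (hF j).add G (hF' j), rfl⟩
      zero_mem' := ⟨_, _, 0, T.graph.zero_mem, fun j => IsEdgeFunction.zero G j, rfl⟩
      smul_mem' := by
        rintro c _ ⟨f, g, F, hm, hF, rfl⟩
        exact ⟨_, _, c • F, T.graph.smul_mem c hm, fun j => (hF j).smul G c, rfl⟩ }
  have hTL : T = G.vertexOp L := by
    refine LinearPMap.eq_of_eq_graph ?_
    rw [vertexOp_graph]
    refine le_antisymm ?_ ?_
    · rintro ⟨f, g⟩ hm
      obtain ⟨F, hF, -⟩ := hmax f g hm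
      exact ⟨F, hF, f, g, F, hm, hF, rfl⟩
    -- Two functions with equal boundary values differ by an element of the domain of `S`, and `T`
    -- extends `S`.
    · rintro ⟨f, g⟩ ⟨F, hF, f', g', F', hm', hF', hv⟩
      have hd : (f - f', g - g') ∈ G.vertexGraph ⊥ := by
        refine ⟨_, G.edgeFunction_sub hF hF', ?_⟩
        change G.bv _ ∈ _
        rw [bv_sub, hv]
        exact (Submodule.mem_bot ℂ).2 (sub_self _)
      have := T.graph.add_mem (hSg hd) hm'
      rwa [Prod.mk_add_mk, sub_add_cancel, sub_add_cancel] at this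
  refine ⟨L, ?_, hTL⟩
  have h := LinearPMap.isSelfAdjoint_def.1 hT
  rw [hTL, vertexOp_adjoint] at h
  exact G.vertexOp_injective h

end StarGraph

variable {n : ℕ}

/-! ### Lagrangian subspaces and self-adjoint pairs -/

/-- The isomorphism of `ℂⁿ × ℂⁿ` with the Euclidean space `ℂ²ⁿ`. -/
def toEuclidean (n : ℕ) : ((Fin n → ℂ) × (Fin n → ℂ)) ≃ₗ[ℂ] EuclideanSpace ℂ (Fin n ⊕ Fin n) :=
  (LinearEquiv.sumArrowLequivProdArrow (Fin n) (Fin n) ℂ ℂ).symm.trans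
    (WithLp.linearEquiv 2 ℂ (Fin n ⊕ Fin n → ℂ)).symm

theorem symp_eq_inner (p q : (Fin n → ℂ) × (Fin n → ℂ)) : symp p q =
    inner ℂ (toEuclidean n ((LinearEquiv.skewSwap ℂ (Fin n → ℂ) (Fin n → ℂ)).symm p))
      (toEuclidean n q) := by
  obtain ⟨q, q'⟩ := q
  rw [PiLp.inner_apply, Fintype.sum_sum_type, symp, Finset.sum_sub_distrib, sub_eq_add_neg,
    ← Finset.sum_neg_distrib]
  congr 1
  · refine Finset.sum_congr rfl fun j _ => ?_
    simp [toEuclidean]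
    ring
  · refine Finset.sum_congr rfl fun j _ => ?_
    simp [toEuclidean]
    ring

/-- By `symp_eq_inner`, a linear isomorphism carries the symplectic complement to an orthogonal
complement in `ℂ²ⁿ`. -/
theorem finrank_add_finrank_sympOrth (L : Submodule ℂ ((Fin n → ℂ) × (Fin n → ℂ))) :
    Module.finrank ℂ L + Module.finrank ℂ (sympOrth L) = n + n := by
  let e := (LinearEquiv.skewSwap ℂ (Fin n → ℂ) (Fin n → ℂ)).symm.trans (toEuclidean n)
  have h : (sympOrth L).map e.toLinearMap = (L.map (toEuclidean n).toLinearMap)ᗮ := by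
    ext x
    rw [Submodule.mem_orthogonal']
    constructor
    · rintro ⟨p, hp, rfl⟩ _ ⟨q, hq, rfl⟩
      exact (symp_eq_inner p q).symm.trans (hp q hq)
    · intro hx
      refine ⟨e.symm x, fun q hq => ?_, e.apply_symm_apply x⟩
      rw [symp_eq_inner]
      have := hx _ ⟨q, hq, rfl⟩
      have e1 : toEuclidean n ((LinearEquiv.skewSwap ℂ (Fin n → ℂ) (Fin n → ℂ)).symm (e.symm x)) = x :=
        e.apply_symm_apply x
      rw [e1]
      exact this
  have h1 := Submodule.finrank_add_finrank_orthogonal (L.map (toEuclidean n).toLinearMap)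
  rw [← h] at h1
  rw [LinearEquiv.finrank_map_eq, LinearEquiv.finrank_map_eq] at h1
  rw [h1]
  simp

/-- The subspace of boundary values satisfying `A p + B p̂ = 0`. -/
def pairKer (A B : Matrix (Fin n) (Fin n) ℂ) : Submodule ℂ ((Fin n → ℂ) × (Fin n → ℂ)) :=
  LinearMap.ker (A.mulVecLin.coprod B.mulVecLin)

theorem mem_pairKer {A B : Matrix (Fin n) (Fin n) ℂ} {p : (Fin n → ℂ) × (Fin n → ℂ)} :
    p ∈ pairKer A B ↔ A *ᵥ p.1 + B *ᵥ p.2 = 0 := Iff.rfl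

theorem rank_add_finrank_pairKer (A B : Matrix (Fin n) (Fin n) ℂ) :
    (Matrix.fromCols A B).rank + Module.finrank ℂ (pairKer A B) = n + n := by
  have h := LinearMap.finrank_range_add_finrank_ker (A.mulVecLin.coprod B.mulVecLin)
  have hr : LinearMap.range (A.mulVecLin.coprod B.mulVecLin) =
      LinearMap.range (Matrix.fromCols A B).mulVecLin := by
    have : A.mulVecLin.coprod B.mulVecLin = (Matrix.fromCols A B).mulVecLin ∘ₗ
        (LinearEquiv.sumArrowLequivProdArrow (Fin n) (Fin n) ℂ ℂ).symm.toLinearMap := by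
      refine LinearMap.ext fun p => ?_
      obtain ⟨p, q⟩ := p
      change A *ᵥ p + B *ᵥ q = Matrix.fromCols A B *ᵥ Sum.elim p q
      rw [Matrix.fromCols_mulVec]
      rfl
    rw [this, LinearMap.range_comp_of_range_eq_top]
    exact LinearEquiv.range _
  rw [hr] at h
  rw [Matrix.rank, pairKer, h]
  simp

/-- For `X = (A B)` the matrix is `X X*`, which has the same rank as `X`. -/
theorem isUnit_of_isSelfAdjointPair {A B : Matrix (Fin n) (Fin n) ℂ} (h : IsSelfAdjointPair A B) :
    IsUnit (A * Aᴴ + B * Bᴴ) := by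
  have h1 := Matrix.rank_self_mul_conjTranspose (Matrix.fromCols A B)
  rw [Matrix.conjTranspose_fromCols_eq_fromRows_conjTranspose, Matrix.fromCols_mul_fromRows,
    h.1] at h1
  rw [← Matrix.mulVec_surjective_iff_isUnit]
  have : LinearMap.range (A * Aᴴ + B * Bᴴ).mulVecLin = ⊤ :=
    Submodule.eq_top_of_finrank_eq (by rw [← Matrix.rank, h1]; simp)
  exact LinearMap.range_eq_top.1 this

/-- Both sides equal the range of `c ↦ (B* c, -A* c)`: `A B* = B A*` puts this range in the kernel,
it is always in the symplectic complement, and all three spaces have dimension `n`. -/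
theorem sympOrth_pairKer {A B : Matrix (Fin n) (Fin n) ℂ} (h : IsSelfAdjointPair A B) :
    sympOrth (pairKer A B) = pairKer A B := by
  have hd : Module.finrank ℂ (pairKer A B) = n := by
    have := rank_add_finrank_pairKer A B
    rw [h.1] at this
    omega
  have hd' : Module.finrank ℂ (sympOrth (pairKer A B)) = n := by
    have := finrank_add_finrank_sympOrth (pairKer A B)
    omega
  let R : (Fin n → ℂ) →ₗ[ℂ] (Fin n → ℂ) × (Fin n → ℂ) := Bᴴ.mulVecLin.prod (-Aᴴ).mulVecLin
  have hR : ∀ c, R c = (Bᴴ *ᵥ c, -(Aᴴ *ᵥ c)) := fun c => by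
    rw [← Matrix.neg_mulVec]; rfl
  have hinj : Function.Injective R := by
    rw [injective_iff_map_eq_zero]
    intro c hc
    rw [hR, Prod.mk_eq_zero, neg_eq_zero] at hc
    have hQ : (A * Aᴴ + B * Bᴴ) *ᵥ c = 0 := by
      rw [Matrix.add_mulVec, ← Matrix.mulVec_mulVec, ← Matrix.mulVec_mulVec, hc.1, hc.2]
      simp
    exact (Matrix.mulVec_injective_iff_isUnit.2 (isUnit_of_isSelfAdjointPair h))
      (hQ.trans (Matrix.mulVec_zero _).symm)
  have hr : Module.finrank ℂ (LinearMap.range R) = n := by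
    rw [LinearMap.finrank_range_of_inj hinj]; simp
  have h1 : LinearMap.range R ≤ pairKer A B := by
    rintro _ ⟨c, rfl⟩
    rw [hR, mem_pairKer, Matrix.mulVec_neg, Matrix.mulVec_mulVec, Matrix.mulVec_mulVec, h.2]
    abel
  have h2 : LinearMap.range R ≤ sympOrth (pairKer A B) := by
    rintro _ ⟨c, rfl⟩ q hq
    have e : symp (R c) q = -(star c ⬝ᵥ (A *ᵥ q.1 + B *ᵥ q.2)) := by
      have e1 : ∀ (X : Matrix (Fin n) (Fin n) ℂ) (x : Fin n → ℂ),
          star c ⬝ᵥ (X *ᵥ x) = ∑ j, conj ((Xᴴ *ᵥ c) j) * x j := by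
        intro X x
        rw [Matrix.dotProduct_mulVec, ← Matrix.conjTranspose_conjTranspose X, ← Matrix.star_mulVec,
          Matrix.conjTranspose_conjTranspose]
        rfl
      rw [dotProduct_add, e1, e1, hR, symp, ← Finset.sum_add_distrib, ← Finset.sum_neg_distrib]
      refine Finset.sum_congr rfl fun j _ => ?_
      simp
      ring
    rw [e, mem_pairKer.1 hq]
    simp
  exact (Submodule.eq_of_le_of_finrank_eq h2 (hr.trans hd'.symm)).symm.trans
    (Submodule.eq_of_le_of_finrank_eq h1 (hr.trans hd.symm))

/-- The rows of `(A B)` represent the functionals `symp (l i)` for a basis `l` of `L`. Their common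
kernel is the symplectic complement, which is `L`; isotropy of the basis gives `A B* = B A*`. -/
theorem exists_isSelfAdjointPair {L : Submodule ℂ ((Fin n → ℂ) × (Fin n → ℂ))}
    (hL : sympOrth L = L) : ∃ A B : Matrix (Fin n) (Fin n) ℂ,
      IsSelfAdjointPair A B ∧ L = pairKer A B := by
  have hd : Module.finrank ℂ L = n := by
    have := finrank_add_finrank_sympOrth L
    rw [hL] at this
    omega
  let l := Module.finBasisOfFinrankEq ℂ L hd
  let A : Matrix (Fin n) (Fin n) ℂ := Matrix.of fun i j => conj ((l i : (Fin n → ℂ) × (Fin n → ℂ)).2 j)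
  let B : Matrix (Fin n) (Fin n) ℂ := Matrix.of fun i j => -conj ((l i : (Fin n → ℂ) × (Fin n → ℂ)).1 j)
  have hAB : ∀ (p : (Fin n → ℂ) × (Fin n → ℂ)) i,
      (A *ᵥ p.1 + B *ᵥ p.2) i = symp (l i : (Fin n → ℂ) × (Fin n → ℂ)) p := by
    intro p i
    simp [A, B, Matrix.mulVec, dotProduct, symp, ← sub_eq_add_neg]
  have hker : L = pairKer A B := by
    ext p
    rw [mem_pairKer]
    constructor
    · intro hp
      ext i
      rw [hAB]
      have : (l i : (Fin n → ℂ) × (Fin n → ℂ)) ∈ sympOrth L := by rw [hL]; exact (l i).2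
      exact this p hp
    · intro hp
      rw [← hL]
      intro q hq
      have hq' : (⟨q, hq⟩ : L) ∈ Submodule.span ℂ (Set.range l) := by rw [l.span_eq]; trivial
      have key : ∀ x ∈ Submodule.span ℂ (Set.range l),
          symp p (x : (Fin n → ℂ) × (Fin n → ℂ)) = 0 := by
        intro x hx
        induction hx using Submodule.span_induction with
        | mem x hx =>
          obtain ⟨i, rfl⟩ := hx
          rw [symp_eq_zero_comm, ← hAB, hp]
          rfl
        | zero => simp [symp]
        | add x y _ _ hx hy =>
          rw [symp_eq_inner] at hx hy ⊢
          rw [Submodule.coe_add, map_add, inner_add_right, hx, hy, add_zero]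
        | smul c x _ hx =>
          rw [symp_eq_inner] at hx ⊢
          rw [Submodule.coe_smul, map_smul, inner_smul_right, hx, mul_zero]
      exact key _ hq'
  refine ⟨A, B, ⟨?_, ?_⟩, hker⟩
  · have := rank_add_finrank_pairKer A B
    rw [← hker, hd] at this
    omega
  · ext i k
    have h : symp (l i : (Fin n → ℂ) × (Fin n → ℂ)) (l k) = 0 := by
      have : (l i : (Fin n → ℂ) × (Fin n → ℂ)) ∈ sympOrth L := by rw [hL]; exact (l i).2
      exact this _ (l k).2
    rw [symp, Finset.sum_sub_distrib, sub_eq_zero] at h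
    simp [A, B, Matrix.mul_apply, h]

/-! ### Complementary pairs -/

/-- With `Q = A A* + B B*` the choice is `C = Q⁻¹ B`, `D = -Q⁻¹ A`. -/
theorem exists_isComplementaryPair {A B : Matrix (Fin n) (Fin n) ℂ} (h : IsSelfAdjointPair A B) :
    ∃ C D, IsComplementaryPair A B C D := by
  have hu := isUnit_of_isSelfAdjointPair h
  set Q := A * Aᴴ + B * Bᴴ with hQdef
  have hdet : IsUnit Q.det := (Matrix.isUnit_iff_isUnit_det Q).1 hu
  have hQh : (Q⁻¹)ᴴ = Q⁻¹ := by
    rw [Matrix.conjTranspose_nonsing_inv]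
    congr 1
    simp [hQdef]
  have h3 : B * (Q⁻¹ * B)ᴴ - A * (-(Q⁻¹ * A))ᴴ = 1 := by
    rw [Matrix.conjTranspose_neg, Matrix.conjTranspose_mul, Matrix.conjTranspose_mul, hQh,
      Matrix.mul_neg, sub_neg_eq_add, ← Matrix.mul_assoc, ← Matrix.mul_assoc, ← Matrix.add_mul,
      add_comm, ← hQdef, Matrix.mul_nonsing_inv Q hdet]
  refine ⟨Q⁻¹ * B, -(Q⁻¹ * A), ⟨?_, ?_⟩, h3⟩
  · have h4 : Matrix.fromCols (Q⁻¹ * B) (-(Q⁻¹ * A)) * Matrix.fromRows Bᴴ (-Aᴴ) = 1 := by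
      rw [Matrix.fromCols_mul_fromRows]
      have := congrArg Matrix.conjTranspose h3
      simpa using this
    refine le_antisymm ((Matrix.rank_le_card_height _).trans_eq (Fintype.card_fin n)) ?_
    have := Matrix.rank_mul_le_left (Matrix.fromCols (Q⁻¹ * B) (-(Q⁻¹ * A))) (Matrix.fromRows Bᴴ (-Aᴴ))
    rw [h4, Matrix.rank_one, Fintype.card_fin] at this
    exact this
  · rw [Matrix.conjTranspose_neg, Matrix.conjTranspose_mul, Matrix.conjTranspose_mul, hQh,
      Matrix.mul_neg, Matrix.neg_mul, neg_inj, Matrix.mul_assoc, Matrix.mul_assoc,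
      ← Matrix.mul_assoc B, ← Matrix.mul_assoc A, h.2]

/-- The column relations for a complementary pair. -/
theorem IsComplementaryPair.column_relations {A B C D : Matrix (Fin n) (Fin n) ℂ}
    (hAB : IsSelfAdjointPair A B) (h : IsComplementaryPair A B C D) :
    Bᴴ * D = Dᴴ * B ∧ Aᴴ * C = Cᴴ * A ∧ Cᴴ * B - Aᴴ * D = 1 ∧ Dᴴ * A - Bᴴ * C = -1 := by
  have h1 := h.2
  have h1' := congrArg Matrix.conjTranspose h1
  simp only [Matrix.conjTranspose_sub, Matrix.conjTranspose_mul, Matrix.conjTranspose_conjTranspose,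
    Matrix.conjTranspose_one] at h1'
  -- The row relations give a right inverse of a square matrix; that it is also a left inverse gives
  -- the column relations.
  have e : Matrix.fromBlocks A B C D * Matrix.fromBlocks (-Dᴴ) Bᴴ Cᴴ (-Aᴴ) = 1 := by
    rw [Matrix.fromBlocks_multiply, ← Matrix.fromBlocks_one]
    congr 1
    · rw [Matrix.mul_neg, neg_add_eq_sub, h1]
    · rw [Matrix.mul_neg, hAB.2]; abel
    · rw [Matrix.mul_neg, h.1.2]; abel
    · rw [Matrix.mul_neg, ← sub_eq_add_neg, h1']
  have e2 := mul_eq_one_comm.1 e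
  rw [Matrix.fromBlocks_multiply, ← Matrix.fromBlocks_one, Matrix.fromBlocks_inj] at e2
  obtain ⟨r1, r2, r3, r4⟩ := e2
  simp only [Matrix.neg_mul] at r1 r2 r3 r4
  refine ⟨?_, ?_, ?_, ?_⟩
  · rwa [neg_add_eq_zero, eq_comm] at r2
  · rwa [← sub_eq_add_neg, sub_eq_zero, eq_comm] at r3
  · rwa [← sub_eq_add_neg] at r4
  · rw [← r1]; abel

/-! ### Resolvents -/

section Resolvent

variable {H : Type*} [NormedAddCommGroup H] [NormedSpace ℂ H]

theorem IsResolventAt.unique {T : H →ₗ.[ℂ] H} {z : ℂ} {R R' : H →L[ℂ] H}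
    (h : IsResolventAt T z R) (h' : IsResolventAt T z R') : R = R' := by
  ext g
  obtain ⟨f, hf, hg⟩ := h.1 g
  have := h'.2 f
  rw [hg] at this
  rw [← hf, this]

theorem IsResolventAt.res_eq {T : H →ₗ.[ℂ] H} {z : ℂ} {R : H →L[ℂ] H} (h : IsResolventAt T z R) :
    res T z = R := by
  have h' : ∃ R : H →L[ℂ] H, IsResolventAt T z R := ⟨R, h⟩
  rw [res, dif_pos h']
  exact h'.choose_spec.unique h

end Resolvent

theorem differentiable_const_smul_comp {X Y Z : Type*} [NormedAddCommGroup X] [NormedSpace ℂ X]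
    [NormedAddCommGroup Y] [NormedSpace ℂ Y] [NormedAddCommGroup Z] [NormedSpace ℂ Z]
    {S : ℂ → Y →L[ℂ] Z} {T : ℂ → X →L[ℂ] Y} (hS : Differentiable ℂ S) (hT : Differentiable ℂ T)
    (k : ℂ) : Differentiable ℂ fun z => k • (S z ∘L T z) :=
  (hS.clm_comp hT).const_smul k

/-! ### Ordering of boundary values by edges and by components -/

section Permutation

variable {n : ℕ}

theorem permMatrix_mulVec (u : Fin n × Fin 2 → ℂ) :
    permMatrix n *ᵥ u = Sum.elim (fun j => u (j, 0)) fun j => u (j, 1) := by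
  ext (i | i) <;>
    simp [permMatrix, Matrix.mulVec, dotProduct]

theorem permMatrix_transpose_mulVec (a b : Fin n → ℂ) :
    (permMatrix n)ᵀ *ᵥ Sum.elim a b = fun jk => ![a jk.1, b jk.1] jk.2 := by
  ext ⟨j, k⟩
  simp only [Matrix.mulVec, dotProduct, Fintype.sum_sum_type, Matrix.transpose_apply, permMatrix,
    Matrix.of_apply, Sum.elim_inl, Sum.elim_inr, Prod.mk.injEq]
  fin_cases k <;> simp

end Permutation

/-! ### Resolvents of the extensions and Krein's formula -/

namespace StarGraph

variable {n : ℕ} (G : StarGraph n)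

theorem eq_zero_of_mem_rho {L : Submodule ℂ ((Fin n → ℂ) × (Fin n → ℂ))} {z : ℂ}
    (hz : z ∈ rho (G.vertexOp L)) {f : G.L2} (hf : (f, z • f) ∈ G.vertexGraph L) : f = 0 := by
  obtain ⟨R, -, hR⟩ := hz
  rw [← vertexOp_graph, LinearPMap.mem_graph_iff] at hf
  obtain ⟨y, hy, hTy⟩ := hf
  have := hR y
  simp only at hy hTy
  rw [hTy, hy, sub_self, map_zero] at this
  exact this.symm

/-- A right inverse of an injective map is a left inverse: `R (T - z) f - f` lies in the kernel of
`T - z`. -/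
theorem isResolventAt_of_mem {L : Submodule ℂ ((Fin n → ℂ) × (Fin n → ℂ))} {z : ℂ}
    {R : G.L2 →L[ℂ] G.L2} (h : ∀ g, (R g, z • R g + g) ∈ G.vertexGraph L)
    (h0 : ∀ f : G.L2, (f, z • f) ∈ G.vertexGraph L → f = 0) :
    IsResolventAt (G.vertexOp L) z R := by
  refine ⟨fun g => ?_, fun f => ?_⟩
  · have := h g
    rw [← vertexOp_graph, LinearPMap.mem_graph_iff] at this
    obtain ⟨y, hy, hTy⟩ := this
    simp only at hy hTy
    exact ⟨y, hy, by rw [hTy, hy, add_sub_cancel_left]⟩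
  · have h1 := h (G.vertexOp L f - z • (f : G.L2))
    have h2 := LinearPMap.mem_graph (G.vertexOp L) f
    rw [vertexOp_graph] at h2
    have h3 := (G.vertexGraph L).sub_mem h1 h2
    rw [Prod.mk_sub_mk] at h3
    refine sub_eq_zero.1 (h0 _ ?_)
    convert h3 using 2
    rw [smul_sub]
    abel

/-- Eigenfunctions at the spectral parameter `z`. -/
theorem evalY_mem_vertexGraph {L : Submodule ℂ ((Fin n → ℂ) × (Fin n → ℂ))} {z : ℂ}
    {u : Fin n × Fin 2 → ℂ} (hu : G.OuterCondition z u 0) (hL : split u ∈ L) :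
    (G.evalY z u, z • G.evalY z u) ∈ G.vertexGraph L := by
  have h := (G.mem_vertexGraph_iff (L := L) (z := z) (f := G.evalY z u) (g := 0)).2
    ⟨u, by rwa [edgeIntegral_zero], hL, by rw [map_zero (G.freeRes z), add_zero]⟩
  rwa [add_zero] at h

/-- An operator given by a symplectically isotropic space of boundary values has no nonreal
eigenvalues. -/
theorem eq_zero_of_im_ne_zero {L : Submodule ℂ ((Fin n → ℂ) × (Fin n → ℂ))} (hL : L ≤ sympOrth L)
    {z : ℂ} (hz : z.im ≠ 0) {f : G.L2} (hf : (f, z • f) ∈ G.vertexGraph L) : f = 0 := by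
  obtain ⟨F, hF, hv⟩ := hf
  have h := G.green_symp hF hF
  have hs : symp (G.bv F) (G.bv F) = 0 := hL hv _ hv
  rw [hs] at h
  change inner ℂ f (z • f) - inner ℂ (z • f) f = 0 at h
  rw [inner_smul_left, inner_smul_right, ← sub_mul, Complex.sub_conj, mul_eq_zero] at h
  rcases h with h | h
  · simp [hz] at h
  · exact inner_self_eq_zero.1 h

theorem T_eq (A B : Matrix (Fin n) (Fin n) ℂ) : G.T A B = G.vertexOp (pairKer A B) := rfl

theorem isSelfAdjointPair_one_zero :
    IsSelfAdjointPair (1 : Matrix (Fin n) (Fin n) ℂ) 0 := by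
  refine ⟨?_, by simp⟩
  have h := rank_add_finrank_pairKer (1 : Matrix (Fin n) (Fin n) ℂ) 0
  refine le_antisymm ((Matrix.rank_le_card_height _).trans_eq (Fintype.card_fin n)) ?_
  have h4 : Matrix.fromCols (1 : Matrix (Fin n) (Fin n) ℂ) (0 : Matrix (Fin n) (Fin n) ℂ) *
      Matrix.fromRows (1 : Matrix (Fin n) (Fin n) ℂ) (0 : Matrix (Fin n) (Fin n) ℂ) = 1 := by
    rw [Matrix.fromCols_mul_fromRows]; simp
  have := Matrix.rank_mul_le_left (Matrix.fromCols (1 : Matrix (Fin n) (Fin n) ℂ)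
    (0 : Matrix (Fin n) (Fin n) ℂ))
    (Matrix.fromRows (1 : Matrix (Fin n) (Fin n) ℂ) (0 : Matrix (Fin n) (Fin n) ℂ))
  rwa [h4, Matrix.rank_one, Fintype.card_fin] at this

/-- If `c j z = 0`, the second column of `Y j z`, extended by zero to the other edges, is an
eigenfunction of `T₀`. -/
theorem c_ne_zero_of_injective {z : ℂ}
    (h : ∀ f : G.L2, (f, z • f) ∈ G.vertexGraph (pairKer 1 0) → f = 0) (j : Fin n) :
    G.c j z ≠ 0 := by
  intro hc
  have hu : G.OuterCondition z (Pi.single (j, 1) 1) 0 := by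
    intro i
    by_cases hij : i = j
    · subst hij; simp [hc]
    · simp [hij]
  have hL : split (Pi.single (j, 1) 1 : Fin n × Fin 2 → ℂ) ∈ pairKer (n := n) 1 0 := by
    rw [mem_pairKer]
    ext i
    simp [split]
  have h0 := h _ (G.evalY_mem_vertexGraph hu hL)
  rw [← map_zero (G.evalY z)] at h0
  have := congrFun (G.evalY_injective z h0) (j, 1)
  simp at this

/-- The data `(h, -M h)` satisfy the outer boundary conditions. -/
theorem outerCondition_weyl {z : ℂ} (hc : ∀ j, G.c j z ≠ 0) (h : Fin n → ℂ) :
    G.OuterCondition z (fun jk => ![h jk.1, -(G.m jk.1 z * h jk.1)] jk.2) 0 := by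
  intro j
  have := hc j
  simp [m]
  field_simp
  ring

/-- A vector `x` in the kernel of `B M - A` yields a solution of `T_{A,B} f = z f` with boundary
values `(x, -M x)`. -/
theorem isUnit_of_injective {A B : Matrix (Fin n) (Fin n) ℂ} {z : ℂ} (hc : ∀ j, G.c j z ≠ 0)
    (h : ∀ f : G.L2, (f, z • f) ∈ G.vertexGraph (pairKer A B) → f = 0) :
    IsUnit (B * G.M z - A) := by
  rw [← Matrix.mulVec_injective_iff_isUnit]
  have key : ∀ x, (B * G.M z - A) *ᵥ x = 0 → x = 0 := by
    intro x hx
    have hL : split (fun jk => ![x jk.1, -(G.m jk.1 z * x jk.1)] jk.2) ∈ pairKer A B := by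
      rw [mem_pairKer]
      have e : (fun j => -(G.m j z * x j)) = -(G.M z *ᵥ x) := by
        ext j
        simp [M, Matrix.mulVec_diagonal]
      change A *ᵥ x + B *ᵥ (fun j => -(G.m j z * x j)) = 0
      rw [e, Matrix.mulVec_neg, Matrix.mulVec_mulVec, ← sub_eq_add_neg, ← Matrix.sub_mulVec,
        ← neg_sub, Matrix.neg_mulVec, hx, neg_zero]
    have h0 := h _ (G.evalY_mem_vertexGraph (G.outerCondition_weyl hc x) hL)
    rw [← map_zero (G.evalY z)] at h0
    ext j
    have := congrFun (G.evalY_injective z h0) (j, 0)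
    simpa using this
  intro x y hxy
  have := key (x - y) (by rw [Matrix.mulVec_sub]; exact sub_eq_zero.2 hxy)
  exact sub_eq_zero.1 this

/-- The operator `g ↦ (free solution) + 𝐘(·, z) K I(g, z)`. -/
def kernelOp (K : Matrix (Fin n × Fin 2) (Fin n × Fin 2) ℂ) (z : ℂ) : G.L2 →L[ℂ] G.L2 :=
  G.freeRes z + ∑ a, ∑ b, K a b • (G.evalYSpan z a ∘L G.edgeFunctional z b)

theorem kernelOp_apply (K : Matrix (Fin n × Fin 2) (Fin n × Fin 2) ℂ) (z : ℂ) (g : G.L2) :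
    G.kernelOp K z g = G.freeRes z g + G.evalY z (K *ᵥ G.edgeIntegral g z) := by
  rw [LinearMap.pi_apply_eq_sum_univ (G.evalY z) (K *ᵥ G.edgeIntegral g z), kernelOp,
    add_apply]
  congr 1
  simp only [sum_apply, smul_apply, ContinuousLinearMap.comp_apply, evalYSpan_apply,
    edgeFunctional_apply, Matrix.mulVec, dotProduct, Finset.sum_smul, smul_smul]
  refine Finset.sum_congr rfl fun a _ => Finset.sum_congr rfl fun b _ => ?_
  congr 2
  ext i
  simp [Pi.single_apply, eq_comm]

theorem differentiable_kernelOp (K : Matrix (Fin n × Fin 2) (Fin n × Fin 2) ℂ) :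
    Differentiable ℂ (G.kernelOp K) := by
  unfold kernelOp
  refine G.differentiable_freeRes.add (Differentiable.fun_sum fun a _ =>
    Differentiable.fun_sum fun b _ => ?_)
  exact differentiable_const_smul_comp (G.differentiable_evalYSpan a)
    (G.differentiable_edgeFunctional b) (K a b)

/-- The matrix expressing the boundary values of `(T_{A,B} - z)⁻¹ g` through `I(g, z)`. -/
def resMatrix (A B : Matrix (Fin n) (Fin n) ℂ) (z : ℂ) :
    Matrix (Fin n × Fin 2) (Fin n × Fin 2) ℂ :=
  (permMatrix n)ᵀ * Matrix.fromBlocks (-((B * G.M z - A)⁻¹ * B)) ((B * G.M z - A)⁻¹ * B * G.M z)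
    (G.M z * (B * G.M z - A)⁻¹ * B - 1) (G.M z - G.M z * (B * G.M z - A)⁻¹ * B * G.M z) *
    permMatrix n

/-- The outer conditions give `ĥ = M (I₁ - h) - I₀` for the boundary data `(h, ĥ)`; inserting this
into `A h + B ĥ = 0` gives `(B M - A) h = B (M I₁ - I₀)`. -/
theorem resMatrix_mulVec (A B : Matrix (Fin n) (Fin n) ℂ) (z : ℂ) (I : Fin n × Fin 2 → ℂ) :
    G.resMatrix A B z *ᵥ I = (permMatrix n)ᵀ *ᵥ Sum.elim
      (((B * G.M z - A)⁻¹ * B) *ᵥ (G.M z *ᵥ (fun j => I (j, 1)) - fun j => I (j, 0)))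
      (G.M z *ᵥ ((fun j => I (j, 1)) - ((B * G.M z - A)⁻¹ * B) *ᵥ
        (G.M z *ᵥ (fun j => I (j, 1)) - fun j => I (j, 0))) - fun j => I (j, 0)) := by
  rw [resMatrix, ← Matrix.mulVec_mulVec, ← Matrix.mulVec_mulVec, permMatrix_mulVec,
    Matrix.fromBlocks_mulVec]
  congr 2
  · simp only [Sum.elim_comp_inl, Sum.elim_comp_inr, Matrix.mulVec_sub, Matrix.neg_mulVec,
      Matrix.mulVec_mulVec]
    abel
  · simp only [Sum.elim_comp_inl, Sum.elim_comp_inr, Matrix.mulVec_sub, Matrix.sub_mulVec,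
      Matrix.mulVec_mulVec, Matrix.one_mulVec, Matrix.mul_assoc]
    abel

theorem isResolventAt_kernelOp {A B : Matrix (Fin n) (Fin n) ℂ} {z : ℂ} (hc : ∀ j, G.c j z ≠ 0)
    (hX : IsUnit (B * G.M z - A))
    (h0 : ∀ f : G.L2, (f, z • f) ∈ G.vertexGraph (pairKer A B) → f = 0) :
    IsResolventAt (G.T A B) z (G.kernelOp (G.resMatrix A B z) z) := by
  rw [T_eq]
  refine G.isResolventAt_of_mem (fun g => ?_) h0
  have hdet : IsUnit (B * G.M z - A).det := (Matrix.isUnit_iff_isUnit_det _).1 hX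
  rw [mem_vertexGraph_iff]
  refine ⟨_, ?_, ?_, (G.kernelOp_apply _ z g).trans (add_comm _ _)⟩
  · intro j
    rw [resMatrix_mulVec, permMatrix_transpose_mulVec]
    have := hc j
    simp [M, Matrix.mulVec_diagonal, m]
    field_simp
    ring
  · rw [resMatrix_mulVec, permMatrix_transpose_mulVec, mem_pairKer]
    set I0 : Fin n → ℂ := fun j => G.edgeIntegral g z (j, 0)
    set I1 : Fin n → ℂ := fun j => G.edgeIntegral g z (j, 1)
    set r := G.M z *ᵥ I1 - I0 with hr
    change A *ᵥ (((B * G.M z - A)⁻¹ * B) *ᵥ r) +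
      B *ᵥ (G.M z *ᵥ (I1 - ((B * G.M z - A)⁻¹ * B) *ᵥ r) - I0) = 0
    have e1 : (B * G.M z - A) *ᵥ (((B * G.M z - A)⁻¹ * B) *ᵥ r) = B *ᵥ r := by
      rw [Matrix.mulVec_mulVec, ← Matrix.mul_assoc, Matrix.mul_nonsing_inv _ hdet, Matrix.one_mul]
    set h := ((B * G.M z - A)⁻¹ * B) *ᵥ r
    rw [Matrix.sub_mulVec, hr, Matrix.mulVec_sub] at e1
    rw [Matrix.mulVec_sub (G.M z), Matrix.mulVec_sub, Matrix.mulVec_sub,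
      Matrix.mulVec_mulVec h]
    rw [sub_eq_iff_eq_add] at e1
    rw [e1]
    abel

/-- Nonreal numbers belong to the resolvent sets, and the injectivity facts on resolvent sets. -/
theorem mem_rho_of_im_ne_zero {A B : Matrix (Fin n) (Fin n) ℂ} (h : IsSelfAdjointPair A B) {z : ℂ}
    (hz : z.im ≠ 0) : z ∈ rho (G.T A B) := by
  have hc := G.c_ne_zero_of_injective (z := z) fun f hf =>
    G.eq_zero_of_im_ne_zero (sympOrth_pairKer isSelfAdjointPair_one_zero).ge hz hf
  have h0 : ∀ f : G.L2, (f, z • f) ∈ G.vertexGraph (pairKer A B) → f = 0 := fun f hf =>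
    G.eq_zero_of_im_ne_zero (sympOrth_pairKer h).ge hz hf
  exact ⟨_, G.isResolventAt_kernelOp hc (G.isUnit_of_injective hc h0) h0⟩

theorem c_ne_zero {z : ℂ} (hz : z ∈ rho G.T₀) (j : Fin n) : G.c j z ≠ 0 :=
  G.c_ne_zero_of_injective (fun _ hf => G.eq_zero_of_mem_rho hz hf) j

theorem isUnit_of_mem_rho {A B : Matrix (Fin n) (Fin n) ℂ} {z : ℂ}
    (hz : z ∈ rho G.T₀ ∩ rho (G.T A B)) : IsUnit (B * G.M z - A) :=
  G.isUnit_of_injective (G.c_ne_zero hz.1) fun _ hf => G.eq_zero_of_mem_rho hz.2 hf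

theorem res_T_eq {A B : Matrix (Fin n) (Fin n) ℂ} {z : ℂ} (hz : z ∈ rho G.T₀ ∩ rho (G.T A B)) :
    res (G.T A B) z = G.kernelOp (G.resMatrix A B z) z :=
  (G.isResolventAt_kernelOp (G.c_ne_zero hz.1) (G.isUnit_of_mem_rho hz)
    fun _ hf => G.eq_zero_of_mem_rho hz.2 hf).res_eq

theorem Γ_apply (z : ℂ) (x : EuclideanSpace ℂ (Fin n)) : G.Γ z x =
    G.evalY z ((permMatrix n)ᵀ *ᵥ Sum.elim (-WithLp.ofLp x) (G.M z *ᵥ WithLp.ofLp x)) := by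
  have : G.Γ z x = G.evalY z (((permMatrix n)ᵀ *
      Matrix.fromRows (-1 : Matrix (Fin n) (Fin n) ℂ) (G.M z)) *ᵥ WithLp.ofLp x) := rfl
  rw [this, ← Matrix.mulVec_mulVec, Matrix.fromRows_mulVec, Matrix.neg_mulVec, Matrix.one_mulVec]

theorem adjoint_Γ_apply (z : ℂ) (g : G.L2) :
    WithLp.ofLp (ContinuousLinearMap.adjoint (G.Γ (conj z)) g) =
      G.M z *ᵥ (fun j => G.edgeIntegral g z (j, 1)) - fun j => G.edgeIntegral g z (j, 0) := by
  ext j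
  have h := ContinuousLinearMap.adjoint_inner_right (G.Γ (conj z)) (EuclideanSpace.single j 1) g
  rw [Γ_apply, inner_evalY, permMatrix_transpose_mulVec, Fintype.sum_prod_type] at h
  simp [EuclideanSpace.inner_single_left] at h
  rw [h, Finset.sum_eq_single j]
  · simp [M, Matrix.mulVec_diagonal, m_conj]
    ring
  · intro i _ hi
    simp [hi, M]
  · simp

/-- The two resolvents share `freeRes`. With `h = (B M - A)⁻¹ B Γ_{z̄}* g`, their boundary data
differ by `(h, -M h)`, and the corresponding solution is `-Γ_z h`. -/
theorem krein_formula {A B : Matrix (Fin n) (Fin n) ℂ} {z : ℂ}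
    (hz : z ∈ rho G.T₀ ∩ rho (G.T A B)) :
    res (G.T A B) z = res G.T₀ z - G.Γ z ∘L
      Matrix.toEuclideanCLM (n := Fin n) (𝕜 := ℂ) ((B * G.M z - A)⁻¹ * B) ∘L
        ContinuousLinearMap.adjoint (G.Γ (conj z)) := by
  have h0 : res G.T₀ z = G.kernelOp (G.resMatrix 1 0 z) z := G.res_T_eq ⟨hz.1, hz.1⟩
  rw [G.res_T_eq hz, h0]
  ext1 g
  rw [sub_apply, ContinuousLinearMap.comp_apply, ContinuousLinearMap.comp_apply,
    kernelOp_apply, kernelOp_apply, Γ_apply, add_sub_assoc, ← map_sub]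
  congr 2
  rw [Matrix.ofLp_toEuclideanCLM, adjoint_Γ_apply, resMatrix_mulVec, resMatrix_mulVec,
    ← Matrix.mulVec_sub]
  congr 1
  set r := G.M z *ᵥ (fun j => G.edgeIntegral g z (j, 1)) - fun j => G.edgeIntegral g z (j, 0)
  ext (i | i)
  · simp
  · simp [Matrix.mulVec_sub]
    ring

end StarGraph

/-! ### Algebras of functions and matrix inversion -/

section FunctionAlgebras

variable {n : ℕ} {S : Subalgebra ℂ (ℂ → ℂ)}

/-- The algebra of meromorphic functions on `ℂ`. -/
def meromorphicSubalgebra : Subalgebra ℂ (ℂ → ℂ) where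
  carrier := {f | Meromorphic f}
  mul_mem' hf hg := hf.mul hg
  add_mem' hf hg := hf.add hg
  algebraMap_mem' r := Meromorphic.const r

/-- The algebra of functions that are holomorphic on `U`. -/
def holomorphicSubalgebra (U : Set ℂ) : Subalgebra ℂ (ℂ → ℂ) where
  carrier := {f | DifferentiableOn ℂ f U}
  mul_mem' hf hg := hf.mul hg
  add_mem' hf hg := hf.add hg
  algebraMap_mem' r := differentiableOn_const r

/-- Stated for an arbitrary subalgebra, the matrix calculus serves both holomorphy off the real line
and meromorphy on `ℂ`. -/
theorem mul_apply_mem {N N' : ℂ → Matrix (Fin n) (Fin n) ℂ} (h : ∀ i k, (fun z => N z i k) ∈ S)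
    (h' : ∀ i k, (fun z => N' z i k) ∈ S) (i k : Fin n) : (fun z => (N z * N' z) i k) ∈ S := by
  have e : (fun z => (N z * N' z) i k) = ∑ l, (fun z => N z i l) * fun z => N' z l k := by
    ext z
    simp [Matrix.mul_apply, Finset.sum_apply]
  rw [e]
  exact S.sum_mem fun l _ => S.mul_mem (h i l) (h' l k)

theorem const_mul_sub_apply_mem {N : ℂ → Matrix (Fin n) (Fin n) ℂ}
    (h : ∀ i k, (fun z => N z i k) ∈ S) (D C : Matrix (Fin n) (Fin n) ℂ) (i k : Fin n) :
    (fun z => (D * N z - C) i k) ∈ S := by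
  have hc : ∀ a : ℂ, (fun _ : ℂ => a) ∈ S := S.algebraMap_mem
  exact S.sub_mem (mul_apply_mem (N := fun _ => D) (fun i k => hc (D i k)) h i k) (hc (C i k))

theorem det_mem {N : ℂ → Matrix (Fin n) (Fin n) ℂ} (h : ∀ i k, (fun z => N z i k) ∈ S) :
    (fun z => (N z).det) ∈ S := by
  have e : (fun z => (N z).det) = ∑ σ : Equiv.Perm (Fin n),
      (((Equiv.Perm.sign σ : ℤ) : ℂ → ℂ)) * ∏ i, fun z => N z (σ i) i := by
    ext z
    simp [Matrix.det_apply', Finset.sum_apply, Finset.prod_apply]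
  rw [e]
  exact S.sum_mem fun σ _ => S.mul_mem (intCast_mem S _) (S.prod_mem fun i _ => h _ _)

theorem adjugate_apply_mem {N : ℂ → Matrix (Fin n) (Fin n) ℂ} (h : ∀ i k, (fun z => N z i k) ∈ S)
    (i k : Fin n) : (fun z => (N z).adjugate i k) ∈ S := by
  simp only [Matrix.adjugate_apply]
  refine det_mem fun a b => ?_
  by_cases hak : a = k
  · subst hak
    simp only [Matrix.updateRow_self]
    exact S.algebraMap_mem _
  · simp only [Matrix.updateRow_ne hak]
    exact h a b

/-- Cramer's rule. It also holds at singular points, where the matrix inverse and the inverse of the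
determinant are both `0` by convention. -/
theorem inv_apply_mem {N : ℂ → Matrix (Fin n) (Fin n) ℂ} (h : ∀ i k, (fun z => N z i k) ∈ S)
    (hdet : (fun z => ((N z).det)⁻¹) ∈ S) (i k : Fin n) : (fun z => (N z)⁻¹ i k) ∈ S := by
  simp only [Matrix.inv_def, Ring.inverse_eq_inv, Matrix.smul_apply, smul_eq_mul]
  exact S.mul_mem hdet (adjugate_apply_mem h i k)

end FunctionAlgebras

/-! ### The symplectic identity for linear fractional transforms -/

section LinearFractional

variable {n : ℕ} {A B C D : Matrix (Fin n) (Fin n) ℂ}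

/-- The column relations remove the terms of degree two and zero. With `N₁ = N₂ = M(z̄)` it gives
the symmetry of `W`, with `N₁ = M(z)*`, `N₂ = M(z)` its imaginary part. -/
theorem IsComplementaryPair.symplectic_identity (hAB : IsSelfAdjointPair A B)
    (h : IsComplementaryPair A B C D) (N₁ N₂ : Matrix (Fin n) (Fin n) ℂ) :
    (N₁ * Bᴴ - Aᴴ) * (D * N₂ - C) - (N₁ * Dᴴ - Cᴴ) * (B * N₂ - A) = N₂ - N₁ := by
  obtain ⟨h1, h2, h3, h4⟩ := h.column_relations hAB
  have e : (N₁ * Bᴴ - Aᴴ) * (D * N₂ - C) - (N₁ * Dᴴ - Cᴴ) * (B * N₂ - A) =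
      N₁ * (Bᴴ * D - Dᴴ * B) * N₂ + (Aᴴ * C - Cᴴ * A) + N₁ * (Dᴴ * A - Bᴴ * C) +
        (Cᴴ * B - Aᴴ * D) * N₂ := by
    noncomm_ring
  rw [e, h1, h2, h3, h4]
  simp [sub_eq_neg_add]

end LinearFractional

namespace StarGraph

variable {n : ℕ} (G : StarGraph n) {A B C D : Matrix (Fin n) (Fin n) ℂ} {z : ℂ}

/-! ### The matrix Nevanlinna function -/

theorem c_ne_zero_of_im_ne_zero (hz : z.im ≠ 0) (j : Fin n) : G.c j z ≠ 0 :=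
  G.c_ne_zero (G.mem_rho_of_im_ne_zero isSelfAdjointPair_one_zero hz) j

theorem isUnit_of_im_ne_zero (h : IsSelfAdjointPair A B) (hz : z.im ≠ 0) :
    IsUnit (B * G.M z - A) :=
  G.isUnit_of_mem_rho
    ⟨G.mem_rho_of_im_ne_zero isSelfAdjointPair_one_zero hz, G.mem_rho_of_im_ne_zero h hz⟩

/-- Green's identity for the Weyl solution on the edge `e_j`, with initial value `(1, -m_j)`, paired
with itself. -/
theorem exists_m_sub_conj (hc : ∀ j, G.c j z ≠ 0) (j : Fin n) :
    ∃ f : G.L2, G.m j z - conj (G.m j z) = (z - conj z) * inner ℂ f f := by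
  have hu := G.outerCondition_weyl hc (Pi.single j 1)
  rw [← G.edgeIntegral_zero z] at hu
  obtain ⟨F, hF, hv⟩ := G.exists_edgeFunction hu
  rw [map_zero (G.freeRes z), add_zero, add_zero] at hF
  have h := G.green_symp hF hF
  rw [inner_smul_left, inner_smul_right, ← sub_mul] at h
  refine ⟨_, Eq.trans ?_ h.symm⟩
  rw [symp, Finset.sum_eq_single j]
  · simp [bv, hv]
    ring
  · intro i _ hi
    simp [bv, hv, hi]
  · simp

theorem conjTranspose_M : (G.M z)ᴴ = G.M (conj z) := by
  rw [M, M, Matrix.diagonal_conjTranspose]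
  congr 1
  ext j
  exact (G.m_conj j z).symm

theorem posSemidef_M (hz : z.im ≠ 0) :
    (((z.im : ℂ)⁻¹ * (2 * Complex.I)⁻¹) • (G.M z - (G.M z)ᴴ)).PosSemidef := by
  rw [M, Matrix.diagonal_conjTranspose, Matrix.diagonal_sub, ← Matrix.diagonal_smul]
  refine Matrix.PosSemidef.diagonal fun j => ?_
  obtain ⟨f, hf⟩ := G.exists_m_sub_conj (G.c_ne_zero_of_im_ne_zero hz) j
  have e : ((z.im : ℂ)⁻¹ * (2 * Complex.I)⁻¹) * (G.m j z - conj (G.m j z)) = inner ℂ f f := by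
    have hz' : (z.im : ℂ) ≠ 0 := by exact_mod_cast hz
    rw [hf, Complex.sub_conj]
    push_cast
    field_simp
  change 0 ≤ ((z.im : ℂ)⁻¹ * (2 * Complex.I)⁻¹) * (G.m j z - conj (G.m j z))
  rw [e, inner_self_eq_norm_sq_to_K]
  have := Complex.zero_le_real.2 (sq_nonneg ‖f‖)
  rwa [Complex.ofReal_pow] at this

theorem W_conj (hAB : IsSelfAdjointPair A B) (h : IsComplementaryPair A B C D) (hz : z.im ≠ 0) :
    G.W A B C D (conj z) = (G.W A B C D z)ᴴ := by
  have hX := G.isUnit_of_im_ne_zero hAB hz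
  have hX' := G.isUnit_of_im_ne_zero hAB (z := conj z) (by simpa using hz)
  have hd := (Matrix.isUnit_iff_isUnit_det _).1 hX
  have hd' := (Matrix.isUnit_iff_isUnit_det _).1 hX'
  have key := h.symplectic_identity hAB (G.M (conj z)) (G.M (conj z))
  rw [sub_self, sub_eq_zero] at key
  have e1 : G.M (conj z) * Bᴴ - Aᴴ = (B * G.M z - A)ᴴ := by
    simp [conjTranspose_M]
  have e2 : G.M (conj z) * Dᴴ - Cᴴ = (D * G.M z - C)ᴴ := by
    simp [conjTranspose_M]
  rw [e1, e2] at key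
  have hdh : IsUnit (B * G.M z - A)ᴴ.det := by
    rw [Matrix.det_conjTranspose]; exact hd.star
  rw [W, W, Matrix.conjTranspose_mul, Matrix.conjTranspose_nonsing_inv,
    ← Matrix.nonsing_inv_mul_cancel_left (B * G.M z - A)ᴴ
      ((D * G.M (conj z) - C) * (B * G.M (conj z) - A)⁻¹) hdh, ← Matrix.mul_assoc (B * G.M z - A)ᴴ,
    key, Matrix.mul_assoc, Matrix.mul_nonsing_inv _ hd', Matrix.mul_one]

theorem W_sub_conjTranspose (hAB : IsSelfAdjointPair A B) (h : IsComplementaryPair A B C D)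
    (hX : IsUnit (B * G.M z - A)) : G.W A B C D z - (G.W A B C D z)ᴴ =
      ((B * G.M z - A)⁻¹)ᴴ * (G.M z - (G.M z)ᴴ) * (B * G.M z - A)⁻¹ := by
  have hd := (Matrix.isUnit_iff_isUnit_det _).1 hX
  have key := h.symplectic_identity hAB (G.M z)ᴴ (G.M z)
  have e1 : (G.M z)ᴴ * Bᴴ - Aᴴ = (B * G.M z - A)ᴴ := by simp
  have e2 : (G.M z)ᴴ * Dᴴ - Cᴴ = (D * G.M z - C)ᴴ := by simp
  have hinv := Matrix.mul_nonsing_inv _ hd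
  have hinv' : ((B * G.M z - A)⁻¹)ᴴ * (B * G.M z - A)ᴴ = 1 := by
    rw [← Matrix.conjTranspose_mul, hinv, Matrix.conjTranspose_one]
  rw [e1, e2] at key
  rw [← key, W, Matrix.conjTranspose_mul]
  generalize B * G.M z - A = X at *
  generalize D * G.M z - C = U at *
  rw [Matrix.mul_sub, Matrix.sub_mul, ← Matrix.mul_assoc _ Xᴴ, hinv', Matrix.one_mul,
    Matrix.mul_assoc _ _ X⁻¹, Matrix.mul_assoc _ X, hinv, Matrix.mul_one]

theorem W_apply_mem {S : Subalgebra ℂ (ℂ → ℂ)} (hm : ∀ j, G.m j ∈ S)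
    (hdet : (fun z => ((B * G.M z - A).det)⁻¹) ∈ S) (i k : Fin n) :
    (fun z => G.W A B C D z i k) ∈ S := by
  have hM : ∀ i k, (fun z => G.M z i k) ∈ S := by
    intro i k
    by_cases hik : i = k
    · subst hik
      simpa [M] using hm i
    · simp only [M, Matrix.diagonal_apply_ne _ hik]
      exact S.zero_mem
  exact mul_apply_mem (const_mul_sub_apply_mem hM D C)
    (inv_apply_mem (const_mul_sub_apply_mem hM B A) hdet) i k

theorem det_apply_mem {S : Subalgebra ℂ (ℂ → ℂ)} (hm : ∀ j, G.m j ∈ S) :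
    (fun z => (B * G.M z - A).det) ∈ S := by
  refine det_mem (const_mul_sub_apply_mem (fun i k => ?_) B A)
  by_cases hik : i = k
  · subst hik
    simpa [M] using hm i
  · simp only [M, Matrix.diagonal_apply_ne _ hik]
    exact S.zero_mem

theorem isMatrixNevanlinna_W (hAB : IsSelfAdjointPair A B) (h : IsComplementaryPair A B C D) :
    IsMatrixNevanlinna (G.W A B C D) where
  holomorphic i k := by
    have hm : ∀ j, G.m j ∈ holomorphicSubalgebra {z : ℂ | z.im ≠ 0} := fun j =>
      (G.differentiable_b j).differentiableOn.div (G.differentiable_c j).differentiableOn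
        fun _ hz => G.c_ne_zero_of_im_ne_zero hz j
    refine G.W_apply_mem hm ?_ i k
    exact DifferentiableOn.inv (G.det_apply_mem hm) fun _ hz =>
      ((Matrix.isUnit_iff_isUnit_det _).1 (G.isUnit_of_im_ne_zero hAB hz)).ne_zero
  symmetric _ hz := G.W_conj hAB h hz
  im_nonneg z hz := by
    rw [G.W_sub_conjTranspose hAB h (G.isUnit_of_im_ne_zero hAB hz), ← Matrix.smul_mul,
      ← Matrix.mul_smul]
    exact (G.posSemidef_M hz).conjTranspose_mul_mul_same _

/-- Each `m_j` is a quotient of entire functions, and sums, products and inverses of meromorphic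
functions are meromorphic. -/
theorem meromorphic_W (A B C D : Matrix (Fin n) (Fin n) ℂ) (i k : Fin n) :
    Meromorphic fun z => G.W A B C D z i k := by
  have hm : ∀ j, G.m j ∈ meromorphicSubalgebra := fun j =>
    Meromorphic.div (fun z => ((G.differentiable_b j).analyticAt z).meromorphicAt)
      fun z => ((G.differentiable_c j).analyticAt z).meromorphicAt
  exact G.W_apply_mem hm (Meromorphic.inv (G.det_apply_mem hm)) i k

/-- Multiplication by `B*` and `A*` makes the numerator of `W` a multiple of its denominator up to
`-1` and `-M`. Thus `W` is traded for `(B M - A)⁻¹`, which occurs in `resMatrix`, up to constant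
matrices. -/
theorem fromRows_mul_W (hAB : IsSelfAdjointPair A B) (h : IsComplementaryPair A B C D)
    (hX : IsUnit (B * G.M z - A)) : Bᴴ * G.W A B C D z = Dᴴ - (B * G.M z - A)⁻¹ ∧
      Aᴴ * G.W A B C D z = Cᴴ - G.M z * (B * G.M z - A)⁻¹ := by
  have hd := (Matrix.isUnit_iff_isUnit_det _).1 hX
  obtain ⟨h1, h2, h3, h4⟩ := h.column_relations hAB
  have e1 : Bᴴ * (D * G.M z - C) = Dᴴ * (B * G.M z - A) - 1 := by
    have : Bᴴ * (D * G.M z - C) = Bᴴ * D * G.M z - Dᴴ * A + (Dᴴ * A - Bᴴ * C) := by noncomm_ring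
    rw [this, h1, h4]
    noncomm_ring
  have e2 : Aᴴ * (D * G.M z - C) = Cᴴ * (B * G.M z - A) - G.M z := by
    have : Aᴴ * (D * G.M z - C) = Cᴴ * B * G.M z - (Cᴴ * B - Aᴴ * D) * G.M z - Aᴴ * C := by
      noncomm_ring
    rw [this, h3, h2]
    noncomm_ring
  constructor
  · rw [W, ← Matrix.mul_assoc, e1, Matrix.sub_mul, Matrix.mul_nonsing_inv_cancel_right _ _ hd,
      Matrix.one_mul]
  · rw [W, ← Matrix.mul_assoc, e2, Matrix.sub_mul, Matrix.mul_nonsing_inv_cancel_right _ _ hd]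

/-- The part of `resMatrix` that does not depend on the spectral parameter. -/
def entireMatrix (A B C D : Matrix (Fin n) (Fin n) ℂ) :
    Matrix (Fin n × Fin 2) (Fin n × Fin 2) ℂ :=
  (permMatrix n)ᵀ * (Matrix.fromBlocks 0 1 (-1) 0 -
    Matrix.fromRows Dᴴ (-Cᴴ) * Matrix.fromCols B (-A)) * permMatrix n

theorem resMatrix_eq (hAB : IsSelfAdjointPair A B) (h : IsComplementaryPair A B C D)
    (hX : IsUnit (B * G.M z - A)) : G.resMatrix A B z =
      (permMatrix n)ᵀ * Matrix.fromRows Bᴴ (-Aᴴ) * G.W A B C D z * Matrix.fromCols B (-A) *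
        permMatrix n + entireMatrix A B C D := by
  have hd := (Matrix.isUnit_iff_isUnit_det _).1 hX
  obtain ⟨h1, h2⟩ := G.fromRows_mul_W hAB h hX
  -- This removes the trailing factor `M` from the right column of `resMatrix`, whose blocks become
  -- `1 + X⁻¹ A` and `-M X⁻¹ A` with `X = B M - A`.
  have hXM : (B * G.M z - A)⁻¹ * B * G.M z = 1 + (B * G.M z - A)⁻¹ * A := by
    have := Matrix.nonsing_inv_mul _ hd
    rw [Matrix.mul_sub, sub_eq_iff_eq_add] at this
    rw [Matrix.mul_assoc, this]
  rw [resMatrix, entireMatrix, Matrix.mul_assoc (permMatrix n)ᵀ _ (G.W A B C D z),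
    Matrix.mul_assoc (permMatrix n)ᵀ _ (Matrix.fromCols B (-A)), ← Matrix.add_mul,
    ← Matrix.mul_add]
  congr 2
  rw [Matrix.fromRows_mul, Matrix.neg_mul, h1, h2, Matrix.fromRows_mul_fromCols,
    Matrix.fromRows_mul_fromCols, sub_eq_add_neg (Matrix.fromBlocks 0 1 (-1) 0),
    Matrix.fromBlocks_neg, Matrix.fromBlocks_add, Matrix.fromBlocks_add]
  congr 1
  · noncomm_ring
  · rw [hXM]
    noncomm_ring
  · noncomm_ring
  · rw [Matrix.mul_assoc (G.M z * _), Matrix.mul_assoc (G.M z), ← Matrix.mul_assoc _ B, hXM]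
    noncomm_ring

theorem res_T_apply (hAB : IsSelfAdjointPair A B) (h : IsComplementaryPair A B C D)
    (hz : z ∈ rho G.T₀ ∩ rho (G.T A B)) (g : G.L2) : res (G.T A B) z g =
      G.evalY z (((permMatrix n)ᵀ * Matrix.fromRows Bᴴ (-Aᴴ) * G.W A B C D z *
        Matrix.fromCols B (-A) * permMatrix n) *ᵥ G.edgeIntegral g z) +
          G.kernelOp (entireMatrix A B C D) z g := by
  rw [G.res_T_eq hz, kernelOp_apply, kernelOp_apply,
    G.resMatrix_eq hAB h (G.isUnit_of_mem_rho hz), Matrix.add_mulVec, map_add]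
  abel

/-- The self-adjoint extensions of the minimal operator. -/
theorem le_and_isSelfAdjoint_iff (T : G.L2 →ₗ.[ℂ] G.L2) : (G.S ≤ T ∧ IsSelfAdjoint T) ↔
    ∃ A B : Matrix (Fin n) (Fin n) ℂ, IsSelfAdjointPair A B ∧ T = G.T A B := by
  constructor
  · rintro ⟨hS, hT⟩
    obtain ⟨L, hL, rfl⟩ := G.exists_eq_vertexOp hS hT
    obtain ⟨A, B, hAB, rfl⟩ := exists_isSelfAdjointPair hL
    exact ⟨A, B, hAB, rfl⟩
  · rintro ⟨A, B, hAB, rfl⟩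
    rw [T_eq]
    refine ⟨G.S_le_vertexOp _, ?_⟩
    rw [LinearPMap.isSelfAdjoint_def, vertexOp_adjoint, sympOrth_pairKer hAB]

end StarGraph

end DiracKrein

end

theorem theorem4p5 {n : ℕ} (G : DiracKrein.StarGraph n) :
    -- the fundamental matrices exist, and `S` is densely defined with the maximal operator as `S*`
    (∀ j z, G.IsFundamentalMatrix j z (G.Y j z)) ∧
    Dense (G.S.domain : Set G.L2) ∧
    G.S.adjoint = G.Smax ∧
    -- (i) the self-adjoint extensions of `S`
    (∀ T : G.L2 →ₗ.[ℂ] G.L2, (G.S ≤ T ∧ IsSelfAdjoint T) ↔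
      ∃ A B : Matrix (Fin n) (Fin n) ℂ, DiracKrein.IsSelfAdjointPair A B ∧ T = G.T A B) ∧
    -- `M(z)` is well defined for `z ∈ ρ(T₀)`
    (∀ z ∈ DiracKrein.rho G.T₀, ∀ j, G.c j z ≠ 0) ∧
    ∀ A B : Matrix (Fin n) (Fin n) ℂ, DiracKrein.IsSelfAdjointPair A B →
      (∀ z : ℂ, z.im ≠ 0 → z ∈ DiracKrein.rho G.T₀ ∩ DiracKrein.rho (G.T A B)) ∧
      -- (ii) Krein's resolvent formula
      (∀ z ∈ DiracKrein.rho G.T₀ ∩ DiracKrein.rho (G.T A B),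
        IsUnit (B * G.M z - A) ∧
        DiracKrein.res (G.T A B) z = DiracKrein.res G.T₀ z -
          G.Γ z ∘L Matrix.toEuclideanCLM (n := Fin n) (𝕜 := ℂ) ((B * G.M z - A)⁻¹ * B) ∘L
            ContinuousLinearMap.adjoint (G.Γ (starRingEnd ℂ z))) ∧
      -- (iii) the matrix Nevanlinna function `W_{A,B}`
      (∃ C D : Matrix (Fin n) (Fin n) ℂ, DiracKrein.IsComplementaryPair A B C D) ∧
      ∀ C D : Matrix (Fin n) (Fin n) ℂ, DiracKrein.IsComplementaryPair A B C D →
        DiracKrein.IsMatrixNevanlinna (G.W A B C D) ∧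
        (∀ i k, Meromorphic fun z => G.W A B C D z i k) ∧
        ∃ F : ℂ → G.L2 →L[ℂ] G.L2, Differentiable ℂ F ∧
          ∀ z ∈ DiracKrein.rho G.T₀ ∩ DiracKrein.rho (G.T A B), ∀ g : G.L2,
            DiracKrein.res (G.T A B) z g =
              G.evalY z (((DiracKrein.permMatrix n)ᵀ * Matrix.fromRows Bᴴ (-Aᴴ) *
                G.W A B C D z * Matrix.fromCols B (-A) * DiracKrein.permMatrix n) *ᵥ
                  G.edgeIntegral g z) + F z g := by
  refine ⟨G.isFundamentalMatrix_Y, G.dense_vertexOp_domain ⊥, G.S_adjoint,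
    G.le_and_isSelfAdjoint_iff, fun _ hz => G.c_ne_zero hz, fun A B hAB => ⟨fun z hz =>
      ⟨G.mem_rho_of_im_ne_zero DiracKrein.StarGraph.isSelfAdjointPair_one_zero hz,
        G.mem_rho_of_im_ne_zero hAB hz⟩,
      fun z hz => ⟨G.isUnit_of_mem_rho hz, G.krein_formula hz⟩,
      DiracKrein.exists_isComplementaryPair hAB, fun C D h => ⟨G.isMatrixNevanlinna_W hAB h,
        G.meromorphic_W A B C D, G.kernelOp (DiracKrein.StarGraph.entireMatrix A B C D),
        G.differentiable_kernelOp _, fun z hz => G.res_T_apply hAB h hz⟩⟩⟩
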